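/- **Setting.** There are $n\ge 1$ agents. Agent $i$ has a private valuation $v_i\in[0,v_{\max}]$ for being served, drawn independently from a distribution $F_i$; write $\mathbf F=F_1\times\dots\times F_n$ and $\mu_{\max}=\max_i \mathbb E[v_i]>0$. A downward-closed set system $\mathcal X\subseteq 2^{\{1,\dots,n\}}$ (subsets of feasible sets are feasible), in which each single agent can be served ($\{i\}\in\mathcal X$ for all $i$), specifies the feasible sets. A (randomized) algorithm $\mathcal A$ maps each valuation profile $\mathbf v\in[0,v_{\max}]^n$ to a random feasible set $\mathcal A(\mathbf v)$ of served agents. Its expected welfare is $\mathbb E_{\mathbf v\sim\mathbf F}\,\mathbb E\big[\sum_{i\in\mathcal A(\mathbf v)}v_i\big]$, and for $\beta>0$ it is a Bayesian $\beta$-approximation if this is at least $\frac1\beta\,\mathbb E_{\mathbf v\sim\mathbf F}\big[\max_{S\in\mathcal X}\sum_{i\in S}v_i\big]$. Let $x_i(z)$ be the probability that agent $i$ is served when it reports $z$ and the other agents' reports are drawn from $\mathbf F_{-i}$, and let $p_i(z)=z\,x_i(z)-\int_0^z x_i(t)\,dt$. The algorithm is $\delta$-BIC if with these (expected) payments no agent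 gains more than $\delta$ by misreporting: $z\,x_i(z)-p_i(z)\ge z\,x_i(z')-p_i(z')-\delta$ for all $i$ and all $z,z'\in[0,v_{\max}]$. **Oracle model.** A reduction knows $n,\varepsilon,v_{\max},\mu_{\max}$ and has access to $\mathcal A$ and $\mathbf F$ only through oracles: it may run $\mathcal A$ on any profile, and may draw a sample from any $F_i$ conditioned on any interval $[a,b)$ (it is told if the interval has probability zero). The running time is the worst-case number of calls to $\mathcal A$. **Theorem.** There are universal constants $C>0$ and $c\in\mathbb N$ such that for all $n\ge1$, $\varepsilon>0$, $v_{\max}>0$ and $\mu_{\max}>0$ there is a reduction in the oracle model with the following property. For all distributions $F_1,\dots,F_n$ on $[0,v_{\max}]$ with maximum mean $\mu_{\max}$, all such set systems $\mathcal X$ and all algorithms $\mathcal A$ for $\mathcal X$, the algorithm $\mathcal A'$ that runs the reduction on the reported profile always outputs a feasible set and is $\varepsilon v_{\max}$-BIC; and for every $\beta>0$, if $\mathcal A$ is a Bayesian $\beta$-approximation, then $\mathcal A'$ is a Bayesian $\beta(1+\varepsilon)$-approximation. The running time of $\mathcal A'$ is $\tilde O\big(n^3\varepsilon^{-2}\log_{1+\varepsilon}(v_{\max}/(\varepsilon\mu_{\max}))\big)$: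 with $g=n^3\varepsilon^{-2}\max\{1,\log_{1+\varepsilon}(v_{\max}/(\varepsilon\mu_{\max}))\}$, each run makes at most $C\max\{1,g\}\,(\log(2+g))^{c}$ calls to $\mathcal A$. Moreover, each run draws at most $C(1+g)^c$ samples from the distributions. -/

import Mathlib

open MeasureTheory ProbabilityTheory

noncomputable section

namespace OracleReduction

/-! ### The Bayesian single-parameter setting -/

/-- A valuation profile of `n` agents. -/
abbrev Profile (n : ℕ) : Type := Fin n → ℝ

/-- An allocation: the set of agents that are served. -/
abbrev Allocation (n : ℕ) : Type := Set (Fin n)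

/-- A randomized algorithm (allocation rule): it maps a profile of reported valuations to a
random allocation. -/
abbrev Algorithm (n : ℕ) : Type := Kernel (Profile n) (Allocation n)

variable {n : ℕ}

/-- The valuation profiles with all valuations in `[0, vmax]`. -/
def valuationBox (n : ℕ) (vmax : ℝ) : Set (Profile n) :=
  {v | ∀ i, v i ∈ Set.Icc 0 vmax}

/-- The social welfare `∑_{i ∈ S} v i` of a (feasible) allocation. -/
def welfare (v : Profile n) (S : Allocation n) : ℝ :=
  ∑ i, S.indicator v i

/-- The optimal social welfare over a feasible set system, at a given profile. -/
def opt (X : Set (Allocation n)) (v : Profile n) : ℝ :=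
  sSup (welfare v '' X)

/-- The optimal expected welfare for independent valuations `v i ∼ F i`. -/
def expectedOpt (F : Fin n → Measure ℝ) (X : Set (Allocation n)) : ℝ :=
  ∫ v, opt X v ∂Measure.pi F

/-- The expected welfare of an algorithm for independent valuations `v i ∼ F i`. -/
def expectedWelfare (F : Fin n → Measure ℝ) (A : Algorithm n) : ℝ :=
  ∫ v, ∫ S, welfare v S ∂A v ∂Measure.pi F

/-- The algorithm is a Bayesian `β`-approximation. -/
def IsBayesianApprox (F : Fin n → Measure ℝ) (X : Set (Allocation n)) (β : ℝ)
    (A : Algorithm n) : Prop :=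
  expectedOpt F X / β ≤ expectedWelfare F A

/-- The algorithm always selects a feasible allocation. -/
def IsFeasibleAlgorithm (vmax : ℝ) (X : Set (Allocation n)) (A : Algorithm n) : Prop :=
  ∀ v ∈ valuationBox n vmax, ∀ᵐ S ∂A v, S ∈ X

/-- The maximum expected valuation of any agent. -/
def muMax (F : Fin n → Measure ℝ) : ℝ :=
  ⨆ i, ∫ z, z ∂F i

/-! ### Incentives -/

/-- The interim allocation rule: the probability that agent `i` is served if it reports `z` and
the other agents report their values, drawn from `F`. -/
def interimAlloc (F : Fin n → Measure ℝ) (A : Algorithm n) (i : Fin n) (z : ℝ) : ℝ :=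
  ∫ v, (A (Function.update v i z)).real {S | i ∈ S} ∂Measure.pi F

/-- The payment rule `p i z = z * x i z - ∫_0^z x i` that belongs to an interim allocation
rule `x`. -/
def interimPayment (x : Fin n → ℝ → ℝ) (i : Fin n) (z : ℝ) : ℝ :=
  z * x i z - ∫ t in (0 : ℝ)..z, x i t

/-- A mechanism with interim allocation rule `x` and interim payment rule `p` is `δ`-Bayesian
incentive compatible: no agent gains more than `δ` by misreporting if the others are truthful. -/
def IsBICMechanism (vmax δ : ℝ) (x p : Fin n → ℝ → ℝ) : Prop :=
  ∀ i, ∀ z ∈ Set.Icc 0 vmax, ∀ z' ∈ Set.Icc 0 vmax,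
    z * x i z - p i z ≥ z * x i z' - p i z' - δ

/-- An algorithm is `δ`-Bayesian incentive compatible if, together with the payment rule
determined by its interim allocation rule, it is a `δ`-Bayesian incentive compatible mechanism. -/
def IsBIC (F : Fin n → Measure ℝ) (vmax δ : ℝ) (A : Algorithm n) : Prop :=
  IsBICMechanism vmax δ (interimAlloc F A) (interimPayment (interimAlloc F A))

/-! ### The oracle model -/

/-- The law of the answer of the distribution oracle to the request `(i, a, b)`: a draw from `F i`
conditioned on the interval `[a, b)`, or a failure message (the left summand) if that interval
has probability zero. -/
def sampleLaw (F : Fin n → Measure ℝ) (r : Fin n × ℝ × ℝ) : Measure (Unit ⊕ ℝ) :=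
  if F r.1 (Set.Ico r.2.1 r.2.2) = 0 then Measure.dirac (Sum.inl ())
  else ((F r.1)[|Set.Ico r.2.1 r.2.2]).map Sum.inr

lemma measurable_sampleLaw (F : Fin n → Measure ℝ) [∀ i, IsProbabilityMeasure (F i)] :
    Measurable (sampleLaw F) := by
  refine measurable_from_prod_countable_right fun i => ?_
  have key : ∀ B : Set ℝ, MeasurableSet B →
      Measurable fun r : ℝ × ℝ => F i (Set.Ico r.1 r.2 ∩ B) := by
    intro B hB
    have hS : MeasurableSet {q : (ℝ × ℝ) × ℝ | (q.1.1 ≤ q.2 ∧ q.2 < q.1.2) ∧ q.2 ∈ B} := by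
      have h1 : MeasurableSet {q : (ℝ × ℝ) × ℝ | q.1.1 ≤ q.2} :=
        measurableSet_le (by fun_prop) (by fun_prop)
      have h2 : MeasurableSet {q : (ℝ × ℝ) × ℝ | q.2 < q.1.2} :=
        measurableSet_lt (by fun_prop) (by fun_prop)
      exact (h1.inter h2).inter (hB.preimage measurable_snd)
    exact measurable_measure_prodMk_left hS
  have h0 : Measurable fun r : ℝ × ℝ => F i (Set.Ico r.1 r.2) := by
    simpa using key Set.univ MeasurableSet.univ
  refine Measure.measurable_of_measurable_coe _ fun B hB => ?_
  have hB' : MeasurableSet (Sum.inr ⁻¹' B : Set ℝ) := hB.preimage measurable_inr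
  have : (fun r : ℝ × ℝ => sampleLaw F (i, r) B) = fun r =>
      if F i (Set.Ico r.1 r.2) = 0 then Measure.dirac (Sum.inl ()) B
      else (F i (Set.Ico r.1 r.2))⁻¹ * F i (Set.Ico r.1 r.2 ∩ Sum.inr ⁻¹' B) := by
    funext r
    unfold sampleLaw
    split_ifs with h
    · rfl
    · rw [Measure.map_apply measurable_inr hB, cond_apply measurableSet_Ico]
  rw [this]
  exact Measurable.ite (h0 (measurableSet_singleton 0)) measurable_const
    (h0.inv.mul (key _ hB'))

/-- The distribution oracle as a Markov kernel. -/
def sampler (F : Fin n → Measure ℝ) [∀ i, IsProbabilityMeasure (F i)] :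
    Kernel (Fin n × ℝ × ℝ) (Unit ⊕ ℝ) :=
  ⟨sampleLaw F, measurable_sampleLaw F⟩

instance (F : Fin n → Measure ℝ) [∀ i, IsProbabilityMeasure (F i)] :
    IsMarkovKernel (sampler F) := by
  refine ⟨fun r => ?_⟩
  change IsProbabilityMeasure (sampleLaw F r)
  unfold sampleLaw
  split_ifs with h
  · infer_instance
  · have := cond_isProbabilityMeasure h
    exact Measure.isProbabilityMeasure_map measurable_inr.aemeasurable

/-- Oracle programs whose current state is an element of `X`. A program may call the algorithm
oracle on a profile computed from its state, or ask the distribution oracle for a draw from the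
distribution of one agent conditioned on an interval, and in both cases append the answer to its
state; it ends by returning an allocation. The oracles are the only access that a program has to
the algorithm and to the distributions, and the only source of its randomness. -/
inductive OracleProgram (n : ℕ) : (X : Type) → [MeasurableSpace X] → Type 1
  | ret {X : Type} [MeasurableSpace X] (f : X → Allocation n) (hf : Measurable f) :
      OracleProgram n X
  | query {X : Type} [MeasurableSpace X] (v : X → Profile n) (hv : Measurable v)
      (P : OracleProgram n (X × Allocation n)) : OracleProgram n X
  | sample {X : Type} [MeasurableSpace X] (r : X → Fin n × ℝ × ℝ) (hr : Measurable r)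
      (P : OracleProgram n (X × (Unit ⊕ ℝ))) : OracleProgram n X

namespace OracleProgram

/-- The number of calls to the algorithm oracle in a run. -/
def calls : {X : Type} → [MeasurableSpace X] → OracleProgram n X → ℕ
  | _, _, ret _ _ => 0
  | _, _, query _ _ P => P.calls + 1
  | _, _, sample _ _ P => P.calls

/-- The number of calls to the distribution oracle in a run. -/
def samples : {X : Type} → [MeasurableSpace X] → OracleProgram n X → ℕ
  | _, _, ret _ _ => 0
  | _, _, query _ _ P => P.samples
  | _, _, sample _ _ P => P.samples + 1

/-- The random output of a program, as a function of its initial state, when the oracles are the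
algorithm `A` and the distributions `F`. All oracle answers are drawn with fresh randomness. -/
def run (A : Algorithm n) (F : Fin n → Measure ℝ) [∀ i, IsProbabilityMeasure (F i)] :
    {X : Type} → [MeasurableSpace X] → OracleProgram n X → Kernel X (Allocation n)
  | _, _, ret f hf => Kernel.deterministic f hf
  | _, _, query v hv P => (P.run A F).comp (Kernel.id.prod (A.comap v hv))
  | _, _, sample r hr P => (P.run A F).comp (Kernel.id.prod ((sampler F).comap r hr))

end OracleProgram

/-- The quantity `n³ ε⁻² log_{1+ε}(vmax / (ε μmax))`, with the logarithm replaced by `1` where it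
is smaller than `1`. -/
def complexityScale (n : ℕ) (ε vmax μ : ℝ) : ℝ :=
  (n : ℝ) ^ 3 * (ε ^ 2)⁻¹ * max 1 (Real.logb (1 + ε) (vmax / (ε * μ)))

end OracleReduction

end

/-! For each agent, the valuations are cut into a first cell `[0, θ)` and cells that grow by the
factor `1 + η` with `η = ε / 10`. Independently of the reports, the reduction estimates the interim
allocation of the algorithm on each cell, groups consecutive cells into blocks, replaces each report
by a draw from `F i` conditioned on its block, and runs the algorithm on the new profile.

The replacement preserves `F i` exactly, however inaccurate the estimates are, because any partition
into blocks is resampled from the correct conditional laws (`bind_replaceLaw`). The agents therefore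
do not interact: the new interim allocation of agent `i` at `z` is the old one averaged over the
replacement of `z` alone (`interimAlloc_replaced`), that is, a block average, averaged once more
over the data.

The blocks iron the interim allocation (`exists_ironing`). Their averages increase, which gives
monotonicity and hence incentive compatibility (`isBIC_of_almost_monotone`). No upper part of a
block has a larger average than the block, so averaging never lowers the amount of service above a
grid point, and by Abel summation it does not lower welfare on the grid (`sum_mul_le_ironed`).
Hoeffding's inequality makes all estimates accurate except with small probability
(`measureReal_compl_goodData_le`), and then both properties hold up to a slack
(`chooseBlocks_spec`); the exceptional data only add their probability to the slack.

Besides factors `1 + η`, the welfare losses are additive multiples of `μmax`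
(`integral_mul_le_replaced`). They become relative losses because the reduction runs the improved
algorithm, which serves only the top agent whenever that is better and so has welfare at least
`μmax` (`muMax_le_improved`). As each of the `n` agents may lose slack times `μmax`, the estimates
need accuracy of order `ε / n`, hence about `n² / ε²` runs per cell. Averages over intervals of
cells are assembled from the cell estimates with samples only, so the calls are linear in the number
of cells. -/

set_option linter.unusedSectionVars false

noncomputable section

namespace OracleReduction

/-! ### Composition of oracle programs and their costs -/

namespace OracleProgram

variable {n : ℕ}

/-- Precomposition of a program with a measurable map of states. -/
def comap : {X : Type} → [MeasurableSpace X] → OracleProgram n X →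
    {Y : Type} → [MeasurableSpace Y] → (f : Y → X) → Measurable f → OracleProgram n Y
  | _, _, ret g hg, _, _, f, hf => ret (g ∘ f) (hg.comp hf)
  | _, _, query v hv P, _, _, f, hf =>
      query (v ∘ f) (hv.comp hf) (P.comap (Prod.map f id) (hf.prodMap measurable_id))
  | _, _, sample r hr P, _, _, f, hf =>
      sample (r ∘ f) (hr.comp hf) (P.comap (Prod.map f id) (hf.prodMap measurable_id))

lemma run_ret (A : Algorithm n) (F : Fin n → Measure ℝ) [∀ i, IsProbabilityMeasure (F i)]
    {X : Type} [MeasurableSpace X] (f : X → Allocation n) (hf : Measurable f) (x : X) :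
    (ret f hf).run A F x = Measure.dirac (f x) := by
  simp [run, Kernel.deterministic_apply]

lemma run_query (A : Algorithm n) [IsMarkovKernel A] (F : Fin n → Measure ℝ)
    [∀ i, IsProbabilityMeasure (F i)] {X : Type} [MeasurableSpace X] (v : X → Profile n)
    (hv : Measurable v) (P : OracleProgram n (X × Allocation n)) (x : X) :
    (query v hv P).run A F x = (A (v x)).bind fun S => P.run A F (x, S) := by
  simp only [run, Kernel.comp_apply, Kernel.prod_apply, Kernel.id_apply, Kernel.comap_apply]
  rw [Measure.dirac_prod, ← Measure.bind_dirac_eq_map _ measurable_prodMk_left,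
    Measure.bind_bind (by fun_prop) (by fun_prop)]
  congr 1
  funext S
  rw [Measure.dirac_bind (Kernel.measurable _)]

lemma run_sample (A : Algorithm n) (F : Fin n → Measure ℝ)
    [∀ i, IsProbabilityMeasure (F i)] {X : Type} [MeasurableSpace X] (r : X → Fin n × ℝ × ℝ)
    (hr : Measurable r) (P : OracleProgram n (X × (Unit ⊕ ℝ))) (x : X) :
    (sample r hr P).run A F x = (sampleLaw F (r x)).bind fun S => P.run A F (x, S) := by
  simp only [run, Kernel.comp_apply, Kernel.prod_apply, Kernel.id_apply, Kernel.comap_apply]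
  rw [Measure.dirac_prod, ← Measure.bind_dirac_eq_map _ measurable_prodMk_left,
    Measure.bind_bind (by fun_prop) (by fun_prop)]
  congr 1
  funext S
  rw [Measure.dirac_bind (Kernel.measurable _)]

lemma calls_comap {X : Type} [MeasurableSpace X] (P : OracleProgram n X) :
    ∀ {Y : Type} [MeasurableSpace Y] (f : Y → X) (hf : Measurable f),
      (P.comap f hf).calls = P.calls := by
  induction P with
  | ret g hg => intro Y _ f hf; simp [comap, calls]
  | query v hv P ih => intro Y _ f hf; simp [comap, calls, ih]
  | sample r hr P ih => intro Y _ f hf; simp [comap, calls, ih]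

lemma samples_comap {X : Type} [MeasurableSpace X] (P : OracleProgram n X) :
    ∀ {Y : Type} [MeasurableSpace Y] (f : Y → X) (hf : Measurable f),
      (P.comap f hf).samples = P.samples := by
  induction P with
  | ret g hg => intro Y _ f hf; simp [comap, samples]
  | query v hv P ih => intro Y _ f hf; simp [comap, samples, ih]
  | sample r hr P ih => intro Y _ f hf; simp [comap, samples, ih]

lemma run_comap (A : Algorithm n) [IsMarkovKernel A] (F : Fin n → Measure ℝ)
    [∀ i, IsProbabilityMeasure (F i)] {X : Type} [MeasurableSpace X] (P : OracleProgram n X) :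
    ∀ {Y : Type} [MeasurableSpace Y] (f : Y → X) (hf : Measurable f) (y : Y),
      (P.comap f hf).run A F y = P.run A F (f y) := by
  induction P with
  | ret g hg => intro Y _ f hf y; simp [comap, run_ret]
  | query v hv P ih => intro Y _ f hf y; simp [comap, run_query, ih]
  | sample r hr P ih => intro Y _ f hf y; simp [comap, run_sample, ih]

end OracleProgram

variable {n : ℕ}

/-- The random map `κ` can be computed with `c` calls to the algorithm and `s` samples: every
program that continues from its result extends to a program that computes that result first. -/
def Implements {X Y : Type} [MeasurableSpace X] [MeasurableSpace Y] (c s : ℕ)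
    (κ : Algorithm n → (Fin n → Measure ℝ) → X → Measure Y) : Prop :=
  (∀ (A : Algorithm n) [IsMarkovKernel A] (F : Fin n → Measure ℝ)
      [∀ i, IsProbabilityMeasure (F i)], Measurable (κ A F) ∧
        ∀ x, IsProbabilityMeasure (κ A F x)) ∧
  ∀ {Z : Type} [MeasurableSpace Z] (f : Z → X), Measurable f →
    ∀ P : OracleProgram n (Z × Y), ∃ Q : OracleProgram n Z,
      Q.calls = P.calls + c ∧ Q.samples = P.samples + s ∧
      ∀ (A : Algorithm n) [IsMarkovKernel A] (F : Fin n → Measure ℝ)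
        [∀ i, IsProbabilityMeasure (F i)] (z : Z),
        Q.run A F z = (κ A F (f z)).bind fun y => P.run A F (z, y)

namespace Implements

variable {X Y Z : Type} [MeasurableSpace X] [MeasurableSpace Y] [MeasurableSpace Z]
  {c s c' s' : ℕ}

lemma deterministic {f : X → Y} (hf : Measurable f) :
    Implements (n := n) 0 0 fun _ _ x => Measure.dirac (f x) := by
  refine ⟨fun A _ F _ => ⟨Measure.measurable_dirac.comp hf, fun x => inferInstance⟩,
    fun {W} _ g hg P => ⟨P.comap (fun z => (z, f (g z))) (by fun_prop), ?_, ?_, ?_⟩⟩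
  · simp [OracleProgram.calls_comap]
  · simp [OracleProgram.samples_comap]
  · intro A _ F _ z
    rw [OracleProgram.run_comap, Measure.dirac_bind (by fun_prop)]

lemma query {v : X → Profile n} (hv : Measurable v) :
    Implements (n := n) 1 0 fun A _ x => A (v x) := by
  refine ⟨fun A _ F _ => ⟨by fun_prop, fun x => inferInstance⟩,
    fun {_} _ g hg P => ⟨.query (v ∘ g) (hv.comp hg) P, by simp [OracleProgram.calls],
      by simp [OracleProgram.samples], ?_⟩⟩
  intro A _ F _ z
  rw [OracleProgram.run_query]; rfl

lemma isProbabilityMeasure_sampleLaw (F : Fin n → Measure ℝ) [∀ i, IsProbabilityMeasure (F i)]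
    (r : Fin n × ℝ × ℝ) : IsProbabilityMeasure (sampleLaw F r) :=
  inferInstanceAs (IsProbabilityMeasure (sampler F r))

lemma sample {r : X → Fin n × ℝ × ℝ} (hr : Measurable r) :
    Implements (n := n) 0 1 fun _ F x => sampleLaw F (r x) := by
  refine ⟨fun A _ F _ => ⟨(measurable_sampleLaw F).comp hr,
      fun _ => isProbabilityMeasure_sampleLaw F _⟩,
    fun {_} _ g hg P => ⟨.sample (r ∘ g) (hr.comp hg) P, by simp [OracleProgram.calls],
      by simp [OracleProgram.samples], ?_⟩⟩
  intro A _ F _ z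
  rw [OracleProgram.run_sample]; rfl

/-- Because `Implements` is phrased with continuations, sequencing is nesting: the second
computation is prepended to the continuation, then the first one to the result, and costs add. -/
lemma bind {κ : Algorithm n → (Fin n → Measure ℝ) → X → Measure Y}
    {η : Algorithm n → (Fin n → Measure ℝ) → X × Y → Measure Z}
    (hκ : Implements c s κ) (hη : Implements c' s' η) :
    Implements (c + c') (s + s') fun A F x => (κ A F x).bind fun y => η A F (x, y) := by
  refine ⟨fun A _ F _ => ⟨?_, fun x => ?_⟩, fun {W} _ g hg P => ?_⟩
  · obtain ⟨h1, h1'⟩ := hκ.1 A F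
    obtain ⟨h2, h2'⟩ := hη.1 A F
    let k1 : Kernel X Y := ⟨κ A F, h1⟩
    let k2 : Kernel (X × Y) Z := ⟨η A F, h2⟩
    have : IsMarkovKernel k1 := ⟨h1'⟩
    have : IsMarkovKernel k2 := ⟨h2'⟩
    -- Measurability in the initial state is inherited from the composition-product of kernels.
    have : (fun x => (κ A F x).bind fun y => η A F (x, y)) = ⇑(k1 ⊗ₖ k2).snd := by
      funext x
      ext B hB
      rw [Kernel.snd_apply' _ _ hB, Kernel.compProd_apply (measurable_snd hB),
        Measure.bind_apply hB (by fun_prop)]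
      rfl
    simp only [this]
    fun_prop
  · have h2 := hη.1 A F
    have := (hκ.1 A F).2 x
    exact isProbabilityMeasure_bind (h2.1.comp measurable_prodMk_left).aemeasurable
      (.of_forall fun y => h2.2 _)
  -- The continuation must not see the intermediate result, so it is pulled back along the map that
  -- forgets it.
  · obtain ⟨Q2, hc2, hs2, hr2⟩ := hη.2 (fun p : W × Y => (g p.1, p.2)) (by fun_prop)
      (P.comap (fun p : (W × Y) × Z => (p.1.1, p.2)) (by fun_prop))
    obtain ⟨Q1, hc1, hs1, hr1⟩ := hκ.2 g hg Q2
    refine ⟨Q1, ?_, ?_, ?_⟩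
    · rw [hc1, hc2, OracleProgram.calls_comap]; ring
    · rw [hs1, hs2, OracleProgram.samples_comap]; ring
    · intro A _ F _ z
      have h2 := (hη.1 A F).1
      rw [hr1, Measure.bind_bind (by fun_prop) (by fun_prop)]
      congr 1
      funext y
      rw [hr2]
      congr 1
      funext w
      rw [OracleProgram.run_comap]

lemma comap {κ : Algorithm n → (Fin n → Measure ℝ) → X → Measure Y} (hκ : Implements c s κ)
    {f : Z → X} (hf : Measurable f) : Implements c s fun A F z => κ A F (f z) :=
  ⟨fun A _ F _ => ⟨(hκ.1 A F).1.comp hf, fun _ => (hκ.1 A F).2 _⟩,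
    fun {_} _ g hg P => hκ.2 (f ∘ g) (hf.comp hg) P⟩

lemma congr {κ η : Algorithm n → (Fin n → Measure ℝ) → X → Measure Y} (hκ : Implements c s κ)
    (h : ∀ (A : Algorithm n) [IsMarkovKernel A] (F : Fin n → Measure ℝ)
      [∀ i, IsProbabilityMeasure (F i)] (x : X), κ A F x = η A F x) : Implements c s η := by
  have h' : ∀ (A : Algorithm n) [IsMarkovKernel A] (F : Fin n → Measure ℝ)
      [∀ i, IsProbabilityMeasure (F i)], κ A F = η A F := fun A _ F _ => funext (h A F)
  refine ⟨fun A _ F _ => h' A F ▸ hκ.1 A F, fun {_} _ g hg P => ?_⟩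
  obtain ⟨Q, h1, h2, h3⟩ := hκ.2 g hg P
  exact ⟨Q, h1, h2, fun A _ F _ z => by rw [h3, h' A F]⟩

lemma map {κ : Algorithm n → (Fin n → Measure ℝ) → X → Measure Y} (hκ : Implements c s κ)
    {f : X → Y → Z} (hf : Measurable (Function.uncurry f)) :
    Implements c s fun A F x => (κ A F x).map (f x) :=
  (hκ.bind (deterministic hf)).congr fun A _ F _ x => by
    rw [← Measure.bind_dirac_eq_map _ (by fun_prop)]; rfl

lemma exists_program {κ : Algorithm n → (Fin n → Measure ℝ) → X → Measure (Allocation n)}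
    (hκ : Implements c s κ) : ∃ P : OracleProgram n X, P.calls = c ∧ P.samples = s ∧
      ∀ (A : Algorithm n) [IsMarkovKernel A] (F : Fin n → Measure ℝ)
        [∀ i, IsProbabilityMeasure (F i)] (x : X), P.run A F x = κ A F x := by
  obtain ⟨Q, h1, h2, h3⟩ := hκ.2 id measurable_id (.ret Prod.snd measurable_snd)
  refine ⟨Q, by simpa [OracleProgram.calls] using h1, by simpa [OracleProgram.samples] using h2,
    fun A _ F _ x => ?_⟩
  rw [h3]
  simp only [OracleProgram.run_ret]
  exact Measure.bind_dirac

/-- Oracle answers use fresh randomness, so computations run one after another from the same state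
are independent. The product law is verified on boxes, splitting off the first coordinate. -/
lemma pi {m : ℕ} {κ : Fin m → Algorithm n → (Fin n → Measure ℝ) → X → Measure Y}
    (hκ : ∀ j, Implements c s (κ j)) :
    Implements (m * c) (m * s) fun A F x => Measure.pi fun j => κ j A F x := by
  induction m with
  | zero =>
    refine Implements.congr (κ := fun _ _ _ => Measure.dirac Fin.elim0)
      (by simpa using deterministic measurable_const) fun A _ F _ x => ?_
    rw [Measure.pi_of_empty _ Fin.elim0]
  | succ m ih =>
    have hcons : Measurable (Function.uncurry fun (p : X × Y) (t : Fin m → Y) =>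
        (Fin.cons p.2 t : Fin (m + 1) → Y)) := by
      refine measurable_pi_iff.2 fun j => ?_
      refine Fin.cases ?_ (fun j => ?_) j
      · simp only [Function.uncurry, Fin.cons_zero]; fun_prop
      · simp only [Function.uncurry, Fin.cons_succ]; fun_prop
    have h2 := ((ih fun j => hκ j.succ).comap (measurable_fst : Measurable (Prod.fst : X × Y → X))).map
      hcons
    rw [show (m + 1) * c = c + m * c by ring, show (m + 1) * s = s + m * s by ring]
    refine ((hκ 0).bind h2).congr fun A _ F _ x => ?_
    have hp : ∀ j, IsProbabilityMeasure (κ j A F x) := fun j => ((hκ j).1 A F).2 x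
    symm
    refine Measure.pi_eq fun t ht => ?_
    have hm := (h2.1 A F).1.comp (measurable_prodMk_left (x := x))
    simp only [Function.comp_def] at hm
    rw [Measure.bind_apply (.univ_pi ht) hm.aemeasurable]
    have key : ∀ y, (Measure.map (fun u : Fin m → Y => (Fin.cons y u : Fin (m + 1) → Y))
        (Measure.pi fun j : Fin m => κ j.succ A F x)) (Set.univ.pi t) =
        (t 0).indicator (fun _ => ∏ j : Fin m, κ j.succ A F x (t j.succ)) y := by
      intro y
      rw [Measure.map_apply (hcons.of_uncurry_left (x := (x, y))) (.univ_pi ht)]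
      by_cases hy : y ∈ t 0
      · rw [Set.indicator_of_mem hy, ← Measure.pi_pi]
        congr 1
        ext u
        simp [Set.mem_pi, Fin.forall_fin_succ, hy]
      · rw [Set.indicator_of_notMem hy]
        have : (fun u : Fin m → Y => (Fin.cons y u : Fin (m + 1) → Y)) ⁻¹' Set.univ.pi t = ∅ := by
          ext u
          simp [Set.mem_pi, Fin.forall_fin_succ, hy]
        rw [this, measure_empty]
    simp only [key]
    rw [lintegral_indicator (ht 0), setLIntegral_const, Fin.prod_univ_succ, mul_comm]

end Implements
end OracleReduction
end

noncomputable section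

namespace OracleReduction

/-! ### Ironing -/

/-- The average of the masses `G` relative to the weights `f` over the indices `[a, b)`. -/
def blockAvg (f G : ℕ → ℝ) (a b : ℕ) : ℝ :=
  (∑ k ∈ Finset.Ico a b, G k) / ∑ k ∈ Finset.Ico a b, f k

/-- `J` maps each index `k < K` to the endpoints of its block, in a partition of `[0, K)` into
consecutive blocks. -/
def IsBlockMap (K : ℕ) (J : ℕ → ℕ × ℕ) : Prop :=
  ∀ k < K, (J k).1 ≤ k ∧ k < (J k).2 ∧ (J k).2 ≤ K ∧
    ∀ j, (J k).1 ≤ j → j < (J k).2 → J j = J k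

section

variable {f G : ℕ → ℝ}

lemma sum_Ico_nonneg (hf : ∀ k, 0 ≤ f k) (a b : ℕ) : 0 ≤ ∑ k ∈ Finset.Ico a b, f k :=
  Finset.sum_nonneg fun k _ => hf k

lemma blockAvg_nonneg (hG : ∀ k, 0 ≤ G k) (hGf : ∀ k, G k ≤ f k) (a b : ℕ) :
    0 ≤ blockAvg f G a b :=
  div_nonneg (sum_Ico_nonneg hG a b) (sum_Ico_nonneg (fun k => (hG k).trans (hGf k)) a b)

lemma blockAvg_le_one (hG : ∀ k, 0 ≤ G k) (hGf : ∀ k, G k ≤ f k) (a b : ℕ) :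
    blockAvg f G a b ≤ 1 :=
  div_le_one_of_le₀ (Finset.sum_le_sum fun k _ => hGf k)
    (sum_Ico_nonneg (fun k => (hG k).trans (hGf k)) a b)

/-- The bounds `0 ≤ G ≤ f` cover the degenerate case: zero weight forces zero mass, in agreement
with the convention `0 / 0 = 0`. -/
lemma sum_mul_blockAvg (hG : ∀ k, 0 ≤ G k) (hGf : ∀ k, G k ≤ f k) (a b : ℕ) :
    (∑ k ∈ Finset.Ico a b, f k) * blockAvg f G a b = ∑ k ∈ Finset.Ico a b, G k := by
  unfold blockAvg
  by_cases h : ∑ k ∈ Finset.Ico a b, f k = 0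
  · have h1 : ∑ k ∈ Finset.Ico a b, G k ≤ 0 := h ▸ Finset.sum_le_sum fun k _ => hGf k
    have := sum_Ico_nonneg hG a b
    rw [h, zero_mul]; linarith
  · field_simp

/-- The average over `[a, c)` is a weighted mean of the averages over the two parts, with positive
weight on the first; if it does not exceed the second average, neither does the first one. -/
lemma blockAvg_le_of_append (hG : ∀ k, 0 ≤ G k) (hGf : ∀ k, G k ≤ f k) {a b c : ℕ} (hab : a ≤ b)
    (hbc : b ≤ c) (hpos : 0 < ∑ k ∈ Finset.Ico a b, f k)
    (h : blockAvg f G a c ≤ blockAvg f G b c) : blockAvg f G a b ≤ blockAvg f G b c := by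
  have h1 := sum_mul_blockAvg hG hGf a b
  have h2 := sum_mul_blockAvg hG hGf b c
  have h3 := sum_mul_blockAvg hG hGf a c
  rw [← Finset.sum_Ico_consecutive f hab hbc, ← Finset.sum_Ico_consecutive G hab hbc,
    ← h1, ← h2] at h3
  have h4 := sum_Ico_nonneg (fun k => (hG k).trans (hGf k)) b c
  refine le_of_mul_le_mul_left ?_ hpos
  nlinarith [mul_le_mul_of_nonneg_left h (add_nonneg hpos.le h4)]

/-- If no block from `a` on starts below `a`, then `a` is a block boundary and no earlier block
crosses it. -/
lemma IsBlockMap.restrict {K a : ℕ} {J : ℕ → ℕ × ℕ} (hJ : IsBlockMap K J) (ha : a ≤ K)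
    (hb : ∀ k, a ≤ k → k < K → a ≤ (J k).1) : IsBlockMap a J := by
  intro k hk
  obtain ⟨h1, h2, h3, h4⟩ := hJ k (hk.trans_le ha)
  refine ⟨h1, h2, ?_, h4⟩
  by_contra! h
  have := hb a le_rfl (h.trans_le h3)
  rw [h4 a (h1.trans hk.le) h] at this
  omega

/-- Replacing the values of `G / f` by their averages over blocks does not change the total. -/
lemma sum_mul_blockAvg_eq (hG : ∀ k, 0 ≤ G k) (hGf : ∀ k, G k ≤ f k) {K : ℕ} {J : ℕ → ℕ × ℕ}
    (hJ : IsBlockMap K J) {b : ℕ} (hb : ∀ k, b ≤ k → k < K → b ≤ (J k).1) :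
    ∑ k ∈ Finset.Ico b K, f k * blockAvg f G (J k).1 (J k).2 = ∑ k ∈ Finset.Ico b K, G k := by
  induction K using Nat.strong_induction_on with
  | _ K ih =>
    rcases le_or_gt K b with hK | hK
    · simp [Finset.Ico_eq_empty_of_le hK]
    obtain ⟨h1, h2, h3, h4⟩ := hJ (K - 1) (by omega)
    set a := (J (K - 1)).1 with ha
    have hend : (J (K - 1)).2 = K := by omega
    have hba : b ≤ a := hb _ (by omega) (by omega)
    have hconst : ∀ k, a ≤ k → k < K → J k = (a, K) := fun k hk hk' =>
      (h4 k hk (by omega)).trans (Prod.ext rfl hend)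
    rw [← Finset.sum_Ico_consecutive _ hba (by omega : a ≤ K),
      ← Finset.sum_Ico_consecutive _ hba (by omega : a ≤ K),
      ih a (by omega) (hJ.restrict (by omega) fun k hk hk' => by rw [hconst k hk hk'])
        fun k hk hk' => hb k hk (by omega)]
    congr 1
    rw [← sum_mul_blockAvg hG hGf a K, Finset.sum_mul]
    refine Finset.sum_congr rfl fun k hk => ?_
    rw [Finset.mem_Ico] at hk
    rw [hconst k hk.1 hk.2]

/-- Abel summation: an increasing nonnegative weight is a nonnegative combination of indicators of
upper tails. -/
lemma sum_mul_nonneg_of_tail {t h : ℕ → ℝ} (ht : Monotone t) (ht0 : 0 ≤ t 0) (K : ℕ)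
    (hh : ∀ c < K, 0 ≤ ∑ k ∈ Finset.Ico c K, h k) : 0 ≤ ∑ k ∈ Finset.range K, t k * h k := by
  have key : ∀ m ≤ K, t (K - m) * ∑ k ∈ Finset.Ico (K - m) K, h k ≤
      ∑ k ∈ Finset.Ico (K - m) K, t k * h k := by
    intro m
    induction m with
    | zero => simp
    | succ m ih =>
      intro hm
      have ih := ih (by omega)
      have e : K - m = K - (m + 1) + 1 := by omega
      rw [Finset.sum_eq_sum_Ico_succ_bot (by omega : K - (m + 1) < K),
        Finset.sum_eq_sum_Ico_succ_bot (by omega : K - (m + 1) < K), ← e, mul_add]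
      have h1 : t (K - (m + 1)) ≤ t (K - m) := ht (by omega)
      have h2 : 0 ≤ ∑ k ∈ Finset.Ico (K - m) K, h k := by
        rcases Nat.eq_zero_or_pos m with rfl | hm'
        · simp
        · exact hh _ (by omega)
      nlinarith [mul_le_mul_of_nonneg_right h1 h2]
  have := key K le_rfl
  rw [Nat.sub_self, Nat.Ico_zero_eq_range] at this
  rcases Nat.eq_zero_or_pos K with rfl | hK
  · simp
  · refine le_trans (mul_nonneg ht0 ?_) this
    simpa using hh 0 hK

/-- Ironing along blocks in which no upper part has a larger average than the block, up to the
slack `s`, loses at most a fraction `s` of the total weighted value. -/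
lemma sum_mul_le_ironed (hG : ∀ k, 0 ≤ G k) (hGf : ∀ k, G k ≤ f k) {t : ℕ → ℝ} (ht : Monotone t)
    (ht0 : 0 ≤ t 0) {K : ℕ} {J : ℕ → ℕ × ℕ} (hJ : IsBlockMap K J) {s : ℝ} (hs : 0 ≤ s)
    (hW : ∀ k < K, ∀ c, (J k).1 ≤ c → c < (J k).2 →
      blockAvg f G c (J k).2 ≤ blockAvg f G (J k).1 (J k).2 + s) :
    ∑ k ∈ Finset.range K, t k * G k ≤
      ∑ k ∈ Finset.range K, t k * (f k * blockAvg f G (J k).1 (J k).2) +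
        s * ∑ k ∈ Finset.range K, t k * f k := by
  have hf : ∀ k, 0 ≤ f k := fun k => (hG k).trans (hGf k)
  -- It suffices that ironing plus slack does not decrease any upper tail of the mass.
  have key := sum_mul_nonneg_of_tail ht ht0 K
    (h := fun k => f k * blockAvg f G (J k).1 (J k).2 - G k + s * f k) ?_
  · rw [Finset.mul_sum, ← Finset.sum_add_distrib, ← sub_nonneg, ← Finset.sum_sub_distrib]
    convert key using 2
    ring
  intro c hc
  obtain ⟨h1, h2, h3, h4⟩ := hJ c hc
  -- A tail from `c` consists of the upper part of the block of `c`, where `hW` applies, and of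
  -- whole blocks, where the totals agree exactly.
  have htail := sum_mul_blockAvg_eq hG hGf hJ (b := (J c).2) (fun k hk hk' => by
    obtain ⟨g1, g2, g3, g4⟩ := hJ k hk'
    by_contra! h
    have e1 := g4 ((J c).2 - 1) (by omega) (by omega)
    have e2 := h4 ((J c).2 - 1) (by omega) (by omega)
    rw [← e1, e2] at g2
    omega)
  rw [Finset.sum_add_distrib, Finset.sum_sub_distrib, ← Finset.mul_sum,
    ← Finset.sum_Ico_consecutive (fun k => f k * _) h2.le h3,
    ← Finset.sum_Ico_consecutive G h2.le h3, htail]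
  have e : ∑ k ∈ Finset.Ico c (J c).2, f k * blockAvg f G (J k).1 (J k).2 =
      (∑ k ∈ Finset.Ico c (J c).2, f k) * blockAvg f G (J c).1 (J c).2 := by
    rw [Finset.sum_mul]
    refine Finset.sum_congr rfl fun k hk => ?_
    rw [Finset.mem_Ico] at hk
    rw [h4 k (h1.trans hk.1) hk.2]
  rw [e, ← sum_mul_blockAvg hG hGf c (J c).2]
  have h5 := mul_le_mul_of_nonneg_left (hW c hc c h1 h2) (sum_Ico_nonneg hf c (J c).2)
  have h6 : ∑ k ∈ Finset.Ico c (J c).2, f k ≤ ∑ k ∈ Finset.Ico c K, f k := by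
    rw [← Finset.sum_Ico_consecutive f h2.le h3]
    linarith [sum_Ico_nonneg hf (J c).2 K]
  nlinarith [mul_le_mul_of_nonneg_left h6 hs]

/-- There is an exact ironing: a partition into blocks of positive weight with increasing averages
such that no upper part of a block has a larger average than the block. -/
lemma exists_ironing (hG : ∀ k, 0 ≤ G k) (hGf : ∀ k, G k ≤ f k) (K : ℕ)
    (hpos : 0 < ∑ k ∈ Finset.Ico 0 K, f k) :
    ∃ J : ℕ → ℕ × ℕ, IsBlockMap K J ∧
      (∀ k < K, 0 < ∑ j ∈ Finset.Ico (J k).1 (J k).2, f j) ∧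
      (∀ k < K, ∀ c, (J k).1 ≤ c → c < (J k).2 →
        blockAvg f G c (J k).2 ≤ blockAvg f G (J k).1 (J k).2) ∧
      ∀ k k', k ≤ k' → k' < K →
        blockAvg f G (J k).1 (J k).2 ≤ blockAvg f G (J k').1 (J k').2 := by
  have hf : ∀ k, 0 ≤ f k := fun k => (hG k).trans (hGf k)
  induction K using Nat.strong_induction_on with
  | _ K ih =>
    have hK : 0 < K := by
      by_contra! h
      simp [Nat.le_zero.1 h] at hpos
    -- The last block is the final segment of largest average; the remaining indices are treated by
    -- induction. Taking the least such start makes the inequality strict before it, which yields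
    -- positive weights.
    have hex : ∃ a, a < K ∧ ∀ c < K, blockAvg f G c K ≤ blockAvg f G a K := by
      obtain ⟨a, ha, h⟩ := Finset.exists_max_image (Finset.range K) (fun a => blockAvg f G a K)
        ⟨0, by simpa using hK⟩
      exact ⟨a, by simpa using ha, fun c hc => h c (by simpa using hc)⟩
    classical
    obtain ⟨haK, hmax⟩ := Nat.find_spec hex
    have hmin := fun m => @Nat.find_min _ _ hex m
    generalize Nat.find hex = a at haK hmax hmin
    have hlt : ∀ c < a, blockAvg f G c K < blockAvg f G a K := by
      intro c hc
      by_contra! h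
      exact hmin c hc ⟨hc.trans haK, fun d hd => (hmax d hd).trans h⟩
    have hposa : 0 < ∑ k ∈ Finset.Ico a K, f k := by
      rcases Nat.eq_zero_or_pos a with rfl | ha
      · exact hpos
      · refine (sum_Ico_nonneg hf a K).lt_of_ne fun h => ?_
        have h1 := hlt 0 ha
        have h2 := blockAvg_nonneg hG hGf 0 K
        rw [blockAvg, blockAvg, ← h, div_zero] at h1
        exact absurd h1 (not_lt.2 h2)
    rcases Nat.eq_zero_or_pos a with rfl | ha
    · exact ⟨fun _ => (0, K), fun k hk => ⟨Nat.zero_le _, hk, le_rfl, fun _ _ _ => rfl⟩,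
        fun _ _ => hpos, fun k hk c _ hc => hmax c hc, fun _ _ _ _ => le_rfl⟩
    -- A weightless initial segment could be appended without changing the average, against the
    -- minimality of `a`.
    have hpos0 : 0 < ∑ k ∈ Finset.Ico 0 a, f k := by
      refine (sum_Ico_nonneg hf 0 a).lt_of_ne fun h => ?_
      have h1 := hlt 0 ha
      have h2 := sum_mul_blockAvg hG hGf 0 a
      rw [← h, zero_mul] at h2
      rw [blockAvg, blockAvg, ← Finset.sum_Ico_consecutive f ha.le haK.le,
        ← Finset.sum_Ico_consecutive G ha.le haK.le, ← h, ← h2, zero_add, zero_add] at h1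
      exact lt_irrefl _ h1
    obtain ⟨J, hJ, hJp, hJW, hJM⟩ := ih a haK hpos0
    -- Extending the last block downwards by its predecessor does not increase its average, so the
    -- predecessor has no larger average.
    have hlast : blockAvg f G (J (a - 1)).1 (J (a - 1)).2 ≤ blockAvg f G a K := by
      obtain ⟨g1, g2, g3, g4⟩ := hJ (a - 1) (by omega)
      have hp := hJp (a - 1) (by omega)
      have e : (J (a - 1)).2 = a := by omega
      rw [e] at hp ⊢
      exact blockAvg_le_of_append hG hGf (by omega) haK.le hp (hmax _ (by omega))
    refine ⟨fun k => if k < a then J k else (a, K), fun k hk => ?_, fun k hk => ?_,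
      fun k hk c => ?_, fun k k' hkk hk => ?_⟩
    · by_cases h : k < a
      · obtain ⟨g1, g2, g3, g4⟩ := hJ k h
        simp only [h, if_true]
        exact ⟨g1, g2, g3.trans haK.le, fun j h1 h2 => by
          rw [if_pos (h2.trans_le g3), g4 j h1 h2]⟩
      · simp only [h, if_false]
        exact ⟨not_lt.1 h, hk, le_rfl, fun j h1 _ => by rw [if_neg (not_lt.2 h1)]⟩
    · by_cases h : k < a
      · simpa only [h, if_true] using hJp k h
      · simpa only [h, if_false] using hposa
    · by_cases h : k < a
      · simpa only [h, if_true] using hJW k h c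
      · simp only [h, if_false]
        exact fun _ hc => hmax c hc
    · by_cases h' : k' < a
      · simpa only [h', hkk.trans_lt h', if_true] using hJM k k' hkk h'
      · by_cases h : k < a
        · simp only [h, h', if_true, if_false]
          exact (hJM k (a - 1) (by omega) (by omega)).trans hlast
        · simp only [h, h', if_false]
          exact le_rfl

end

end OracleReduction
end

noncomputable section

namespace OracleReduction

/-! ### Product measures and mixtures -/

lemma isProbabilityMeasure_update {ι Y : Type*} [MeasurableSpace Y] [DecidableEq ι] {μ : ι → Measure Y}
    [∀ i, IsProbabilityMeasure (μ i)] (i : ι) (m : Measure Y) [IsProbabilityMeasure m] (j : ι) :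
    IsProbabilityMeasure (Function.update μ i m j) := by
  rcases eq_or_ne j i with rfl | h
  · simpa
  · simpa [h] using inferInstanceAs (IsProbabilityMeasure (μ j))

lemma measurable_update_uncurry {ι Y : Type*} [MeasurableSpace Y] [DecidableEq ι] (i : ι) :
    Measurable (Function.uncurry fun (w : Y) (v : ι → Y) => Function.update v i w) := by
  refine measurable_pi_iff.2 fun j => ?_
  rcases eq_or_ne j i with rfl | h
  · simpa [Function.uncurry] using measurable_fst
  · simp only [Function.uncurry, Function.update_of_ne h]; fun_prop

section

variable {X Y Z : Type*} [MeasurableSpace X] [MeasurableSpace Y] [MeasurableSpace Z]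

lemma integrable_of_bounded {μ : Measure X} [IsFiniteMeasure μ] {h : X → ℝ} (hm : Measurable h)
    {a b : ℝ} (hb : ∀ x, h x ∈ Set.Icc a b) : Integrable h μ :=
  .of_mem_Icc a b hm.aemeasurable (.of_forall hb)

lemma integral_mem_unitInterval {μ : Measure X} [IsProbabilityMeasure μ] {h : X → ℝ}
    (hb : ∀ x, h x ∈ Set.Icc (0 : ℝ) 1) : ∫ x, h x ∂μ ∈ Set.Icc (0 : ℝ) 1 := by
  refine ⟨integral_nonneg fun x => (hb x).1, ?_⟩
  have := integral_mono_of_nonneg (μ := μ) (.of_forall fun x => (hb x).1)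
    (integrable_const (1 : ℝ)) (.of_forall fun x => (hb x).2)
  simpa using this

lemma measurable_integral_of_measurable {κ : X → Measure Y} (hκ : Measurable κ)
    (hp : ∀ x, IsProbabilityMeasure (κ x)) {h : Y → ℝ} (hm : Measurable h) :
    Measurable fun x => ∫ y, h y ∂κ x := by
  let k : Kernel X Y := ⟨κ, hκ⟩
  have : IsMarkovKernel k := ⟨hp⟩
  exact (hm.stronglyMeasurable.integral_kernel (κ := k)).measurable

lemma integral_bind_of_bounded {μ : Measure X} [IsProbabilityMeasure μ] {κ : X → Measure Y}
    (hκ : Measurable κ) (hp : ∀ x, IsProbabilityMeasure (κ x)) {h : Y → ℝ} (hm : Measurable h)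
    {a b : ℝ} (hb : ∀ x, h x ∈ Set.Icc a b) :
    ∫ y, h y ∂μ.bind κ = ∫ x, ∫ y, h y ∂κ x ∂μ := by
  let k : Kernel X Y := ⟨κ, hκ⟩
  have : IsMarkovKernel k := ⟨hp⟩
  have := Kernel.integral_comp (η := k) (κ := Kernel.const Unit μ) (a := ()) (f := h)
    (integrable_of_bounded hm hb)
  simp only [Kernel.comp_apply, Kernel.const_apply] at this
  exact this

lemma measurable_map_uncurry {μ : Measure Y} [IsProbabilityMeasure μ] {g : X → Y → Z}
    (hg : Measurable (Function.uncurry g)) : Measurable fun x => μ.map (g x) := by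
  have : (fun x => μ.map (g x)) =
      ⇑((Kernel.id ×ₖ Kernel.const X μ).map (Function.uncurry g)) := by
    funext x
    rw [Kernel.map_apply _ hg, Kernel.prod_apply, Kernel.id_apply, Kernel.const_apply,
      Measure.dirac_prod, Measure.map_map hg measurable_prodMk_left]
    rfl
  rw [this]
  exact Kernel.measurable _

end

section

variable {ι : Type*} [Fintype ι] {X : Type*} {Y Z : Type*} [MeasurableSpace X]
  [MeasurableSpace Y] [MeasurableSpace Z]

lemma measurable_pi_measure {κ : ι → X → Measure Y} (hκ : ∀ i, Measurable (κ i))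
    (hp : ∀ i x, IsProbabilityMeasure (κ i x)) :
    Measurable fun x => Measure.pi fun i => κ i x := by
  refine Measurable.measure_of_isPiSystem_of_isProbabilityMeasure generateFrom_pi.symm
    isPiSystem_pi ?_
  rintro _ ⟨t, ht, rfl⟩
  simp only [Measure.pi_pi]
  exact Finset.measurable_fun_prod _ fun i _ =>
    (Measure.measurable_coe (ht i (Set.mem_univ i))).comp (hκ i)

lemma lintegral_pi_prod {μ : ι → Measure Y} [∀ i, IsProbabilityMeasure (μ i)]
    {g : ι → Y → ENNReal} (hg : ∀ i, Measurable (g i)) :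
    ∫⁻ v, ∏ i, g i (v i) ∂Measure.pi μ = ∏ i, ∫⁻ y, g i y ∂μ i := by
  have h := (iIndepFun_pi (μ := μ) fun i => (hg i).aemeasurable)
  have h' := lintegral_prod_eq_prod_lintegral_of_indepFun Finset.univ _ h
    fun i => (hg i).comp (measurable_pi_apply i)
  rw [h']
  refine Finset.prod_congr rfl fun i _ => ?_
  exact (measurePreserving_eval μ i).lintegral_comp (hg i)

/-- Acting on each coordinate by its own kernel keeps the coordinates independent: on a box, both
sides are products of one-dimensional integrals. -/
lemma pi_bind_pi {μ : ι → Measure Y} [∀ i, IsProbabilityMeasure (μ i)]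
    {τ : ι → Y → Measure Z} (hτ : ∀ i, Measurable (τ i))
    (hp : ∀ i y, IsProbabilityMeasure (τ i y)) :
    (Measure.pi μ).bind (fun v => Measure.pi fun i => τ i (v i)) =
      Measure.pi fun i => (μ i).bind (τ i) := by
  have : ∀ i, IsProbabilityMeasure ((μ i).bind (τ i)) := fun i =>
    isProbabilityMeasure_bind (hτ i).aemeasurable (.of_forall (hp i))
  symm
  refine Measure.pi_eq fun t ht => ?_
  have hm : Measurable fun v : ι → Y => Measure.pi fun i => τ i (v i) :=
    measurable_pi_measure (fun i => (hτ i).comp (measurable_pi_apply i)) fun i v => hp i _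
  rw [Measure.bind_apply (.univ_pi ht) hm.aemeasurable]
  simp only [Measure.pi_pi]
  rw [lintegral_pi_prod (g := fun i y => τ i y (t i))
    fun i => (Measure.measurable_coe (ht i)).comp (hτ i)]
  refine Finset.prod_congr rfl fun i _ => ?_
  rw [Measure.bind_apply (ht i) (hτ i).aemeasurable]

/-- This connects interim quantities, where one coordinate is overwritten, with product measures
that have one factor exchanged. -/
lemma pi_update_eq_bind [DecidableEq ι] {μ : ι → Measure Y} [∀ i, IsProbabilityMeasure (μ i)]
    (i : ι) (m : Measure Y) [IsProbabilityMeasure m] :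
    Measure.pi (Function.update μ i m) =
      m.bind fun w => (Measure.pi μ).map fun v => Function.update v i w := by
  have := isProbabilityMeasure_update (μ := μ) i m
  have hupd := measurable_update_uncurry (Y := Y) i
  have hm := measurable_map_uncurry (μ := Measure.pi μ) hupd
  refine Measure.pi_eq fun t ht => ?_
  rw [Measure.bind_apply (.univ_pi ht) hm.aemeasurable]
  have key : ∀ w, ((Measure.pi μ).map fun v => Function.update v i w) (Set.univ.pi t) =
      (t i).indicator (fun _ => ∏ j ∈ Finset.univ.erase i, μ j (t j)) w := by
    intro w
    rw [Measure.map_apply (hupd.of_uncurry_left (x := w)) (.univ_pi ht)]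
    by_cases hw : w ∈ t i
    · rw [Set.indicator_of_mem hw]
      have e : (fun v : ι → Y => Function.update v i w) ⁻¹' Set.univ.pi t =
          Set.univ.pi (Function.update t i Set.univ) := by
        ext v
        simp only [Set.mem_preimage, Set.mem_univ_pi]
        refine forall_congr' fun j => ?_
        rcases eq_or_ne j i with rfl | h
        · simpa
        · simp [h]
      rw [e, Measure.pi_pi, ← Finset.mul_prod_erase _ _ (Finset.mem_univ i)]
      simp only [Function.update_self, measure_univ, one_mul]
      refine Finset.prod_congr rfl fun j hj => ?_
      rw [Function.update_of_ne (Finset.ne_of_mem_erase hj)]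
    · rw [Set.indicator_of_notMem hw]
      have e : (fun v : ι → Y => Function.update v i w) ⁻¹' Set.univ.pi t = ∅ := by
        ext v
        simp only [Set.mem_preimage, Set.mem_univ_pi, Set.mem_empty_iff_false, iff_false,
          not_forall]
        exact ⟨i, by simpa⟩
      rw [e, measure_empty]
  simp only [key]
  rw [lintegral_indicator (ht i), setLIntegral_const,
    ← Finset.mul_prod_erase _ _ (Finset.mem_univ i), Function.update_self, mul_comm]
  congr 1
  refine Finset.prod_congr rfl fun j hj => ?_
  rw [Function.update_of_ne (Finset.ne_of_mem_erase hj)]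

lemma integral_pi_update [DecidableEq ι] {μ : ι → Measure Y} [∀ i, IsProbabilityMeasure (μ i)]
    (i : ι) (m : Measure Y) [IsProbabilityMeasure m] {h : (ι → Y) → ℝ} (hh : Measurable h)
    {a b : ℝ} (hb : ∀ v, h v ∈ Set.Icc a b) :
    ∫ v, h v ∂Measure.pi (Function.update μ i m) =
      ∫ w, ∫ v, h (Function.update v i w) ∂Measure.pi μ ∂m := by
  have hupd := measurable_update_uncurry (Y := Y) i
  rw [pi_update_eq_bind, integral_bind_of_bounded (measurable_map_uncurry hupd)
    (fun w => Measure.isProbabilityMeasure_map (hupd.of_uncurry_left (x := w)).aemeasurable) hh hb]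
  refine integral_congr_ae (.of_forall fun w => ?_)
  exact integral_map (hupd.of_uncurry_left (x := w)).aemeasurable hh.aestronglyMeasurable

lemma map_update_pi [DecidableEq ι] {μ : ι → Measure Y} [∀ i, IsProbabilityMeasure (μ i)]
    (i : ι) (z : Y) :
    (Measure.pi μ).map (fun v => Function.update v i z) =
      Measure.pi (Function.update μ i (Measure.dirac z)) := by
  rw [pi_update_eq_bind, Measure.dirac_bind (measurable_map_uncurry (measurable_update_uncurry i))]

/-- **Hoeffding's inequality** for the average of independent copies of a variable in `[0, 1]`. -/
lemma measure_average_deviation_le {ν : Measure Y} [IsProbabilityMeasure ν] {h : Y → ℝ}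
    (hm : Measurable h) (hb : ∀ y, h y ∈ Set.Icc (0 : ℝ) 1) {N : ℕ} (hN : 0 < N) {e : ℝ}
    (he : 0 ≤ e) :
    (Measure.pi fun _ : Fin N => ν).real {y | e < |(∑ j, h (y j)) / N - ∫ y, h y ∂ν|} ≤
      2 * Real.exp (-(2 * N * e ^ 2)) := by
  set m := ∫ y, h y ∂ν
  have hN' : (0 : ℝ) < N := by exact_mod_cast hN
  -- One-sided tail, to be used for `h` and for `-h`. The sub-Gaussian parameter `(1 / 2) ^ 2` is
  -- Hoeffding's lemma for a range of length one.
  have side : ∀ h : Y → ℝ, Measurable h → (∀ y, h y ∈ Set.Icc (-1 : ℝ) 1) →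
      (HasSubgaussianMGF (fun y => h y - ∫ y, h y ∂ν) ((1 / 2) ^ 2) ν) →
      (Measure.pi fun _ : Fin N => ν).real
        {y | N * e ≤ ∑ j, (h (y j) - ∫ y, h y ∂ν)} ≤ Real.exp (-(2 * N * e ^ 2)) := by
    intro h hm hb hs
    have hi : iIndepFun (fun (j : Fin N) (y : Fin N → Y) => h (y j) - ∫ y, h y ∂ν)
        (Measure.pi fun _ : Fin N => ν) :=
      iIndepFun_pi (μ := fun _ : Fin N => ν) (X := fun _ y => h y - ∫ y, h y ∂ν)
        fun j => (hm.sub_const _).aemeasurable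
    have := HasSubgaussianMGF.measure_sum_ge_le_of_iIndepFun hi (s := Finset.univ)
      (c := fun _ => (1 / 2) ^ 2) (fun j _ => ?_) (ε := N * e) (by positivity)
    · refine this.trans (le_of_eq ?_)
      congr 1
      simp
      field_simp
    · have e1 := (measurePreserving_eval (fun _ : Fin N => ν) j)
      refine HasSubgaussianMGF.of_map (Y := fun y : Fin N → Y => y j)
        (X := fun y => h y - ∫ y, h y ∂ν) e1.measurable.aemeasurable ?_
      rw [e1.map_eq]
      exact hs
  have s1 := hasSubgaussianMGF_of_mem_Icc (μ := ν) hm.aemeasurable (.of_forall hb)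
  have e1 : ((‖(1 : ℝ) - 0‖₊ / 2) ^ 2 : NNReal) = (1 / 2) ^ 2 := by simp
  rw [e1] at s1
  have s2 := s1.neg
  have b1 := side h hm (fun y => ⟨by linarith [(hb y).1], (hb y).2⟩) s1
  have b2 := side (fun y => -h y) hm.neg
    (fun y => ⟨by linarith [(hb y).2], by linarith [(hb y).1]⟩) (by
      convert s2 using 1
      funext y
      simp [integral_neg]
      ring)
  have hsub : {y : Fin N → Y | e < |(∑ j, h (y j)) / N - m|} ⊆
      {y | N * e ≤ ∑ j, (h (y j) - m)} ∪ {y | N * e ≤ ∑ j, (-h (y j) - ∫ y, -h y ∂ν)} := by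
    intro y hy
    simp only [Set.mem_ofPred_eq, lt_abs] at hy
    simp only [Set.mem_union, Set.mem_ofPred_eq, integral_neg, Finset.sum_sub_distrib,
      Finset.sum_const, Finset.card_univ, Fintype.card_fin, nsmul_eq_mul, Finset.sum_neg_distrib]
    rcases hy with hy | hy
    · left
      have := mul_lt_mul_of_pos_left hy hN'
      rw [mul_sub, mul_div_cancel₀ _ hN'.ne'] at this
      exact this.le
    · right
      have := mul_lt_mul_of_pos_left hy hN'
      rw [mul_neg, mul_sub, mul_div_cancel₀ _ hN'.ne'] at this
      change (N : ℝ) * e ≤ _ - N * (-m)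
      linarith
  refine (measureReal_mono hsub).trans ((measureReal_union_le _ _).trans ?_)
  linarith

end

end OracleReduction
end

noncomputable section

namespace OracleReduction

/-! ### Grids -/

/-- The index `k < K` of the grid cell `[t k, t (k + 1))` that contains `z`. -/
def cell (t : ℕ → ℝ) (K : ℕ) (z : ℝ) : ℕ :=
  ((Finset.range (K - 1)).filter fun k => t (k + 1) ≤ z).card

section

variable {t : ℕ → ℝ} {K : ℕ}

/-- Only the `K - 1` interior grid points are counted, so the index is legal even for values outside
the grid. -/
lemma cell_lt (hK : 0 < K) (z : ℝ) : cell t K z < K := by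
  have := Finset.card_filter_le (Finset.range (K - 1)) fun k => t (k + 1) ≤ z
  rw [Finset.card_range] at this
  unfold cell
  omega

lemma measurable_cell : Measurable (cell t K) := by
  unfold cell
  simp only [Finset.card_filter]
  exact Finset.measurable_fun_sum _ fun k _ =>
    Measurable.ite (measurableSet_le measurable_const measurable_id) measurable_const
      measurable_const

lemma cell_mono {z z' : ℝ} (h : z ≤ z') : cell t K z ≤ cell t K z' :=
  Finset.card_le_card fun k hk => by
    simp only [Finset.mem_filter] at hk ⊢
    exact ⟨hk.1, hk.2.trans h⟩

lemma cell_eq (ht : Monotone t) {k : ℕ} (hk : k < K) {z : ℝ}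
    (hz : z ∈ Set.Ico (t k) (t (k + 1))) : cell t K z = k := by
  have : (Finset.range (K - 1)).filter (fun k => t (k + 1) ≤ z) = Finset.range k := by
    ext j
    simp only [Finset.mem_filter, Finset.mem_range]
    constructor
    · rintro ⟨_, h⟩
      by_contra! hkj
      exact absurd (hz.2.trans_le ((ht (by omega : k + 1 ≤ j + 1)).trans h)) (lt_irrefl _)
    · intro h
      exact ⟨by omega, (ht (by omega : j + 1 ≤ k)).trans hz.1⟩
  rw [cell, this, Finset.card_range]

lemma exists_cell {z : ℝ} (hz : z ∈ Set.Ico (t 0) (t K)) :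
    ∃ k < K, z ∈ Set.Ico (t k) (t (k + 1)) := by
  classical
  have h : ∃ k, z < t k := ⟨K, hz.2⟩
  have h0 : Nat.find h ≠ 0 := fun h0 => absurd (h0 ▸ Nat.find_spec h) (not_lt.2 hz.1)
  obtain ⟨k, hk⟩ := Nat.exists_eq_succ_of_ne_zero h0
  refine ⟨k, ?_, ?_, ?_⟩
  · have := Nat.find_min' h hz.2
    omega
  · exact not_lt.1 (Nat.find_min h (by omega : k < Nat.find h))
  · have := Nat.find_spec h
    rwa [hk] at this

lemma mem_cell (ht : Monotone t) {z : ℝ} (hz : z ∈ Set.Ico (t 0) (t K)) :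
    z ∈ Set.Ico (t (cell t K z)) (t (cell t K z + 1)) := by
  obtain ⟨k, hk, h⟩ := exists_cell hz
  rwa [cell_eq ht hk h]

/-- The probability of a grid cell. -/
def cellMass (μ : Measure ℝ) (t : ℕ → ℝ) (k : ℕ) : ℝ :=
  μ.real (Set.Ico (t k) (t (k + 1)))

/-- The integral of a function over a grid cell. -/
def cellIntegral (μ : Measure ℝ) (t : ℕ → ℝ) (h : ℝ → ℝ) (k : ℕ) : ℝ :=
  ∫ z in Set.Ico (t k) (t (k + 1)), h z ∂μ

variable {μ : Measure ℝ} [IsProbabilityMeasure μ] {h : ℝ → ℝ}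

lemma sum_cellIntegral (ht : Monotone t) (hi : Integrable h μ) {a b : ℕ} (hab : a ≤ b) :
    ∑ k ∈ Finset.Ico a b, cellIntegral μ t h k = ∫ z in Set.Ico (t a) (t b), h z ∂μ := by
  induction b, hab using Nat.le_induction with
  | base => simp
  | succ b hb ih =>
    rw [Finset.sum_Ico_succ_top hb, ih, cellIntegral,
      ← Set.Ico_union_Ico_eq_Ico (ht hb) (ht (Nat.le_succ b)),
      setIntegral_union (by
        rw [Set.disjoint_left]
        exact fun z hz hz' => absurd hz.2 (not_lt.2 hz'.1)) measurableSet_Ico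
        hi.integrableOn hi.integrableOn]

lemma sum_cellMass (ht : Monotone t) {a b : ℕ} (hab : a ≤ b) :
    ∑ k ∈ Finset.Ico a b, cellMass μ t k = μ.real (Set.Ico (t a) (t b)) := by
  have := sum_cellIntegral (μ := μ) ht (integrable_const (1 : ℝ)) hab
  simpa [cellIntegral, cellMass] using this

lemma cellIntegral_nonneg (hh : ∀ z, h z ∈ Set.Icc (0 : ℝ) 1) (k : ℕ) :
    0 ≤ cellIntegral μ t h k :=
  integral_nonneg fun z => (hh z).1

lemma cellIntegral_le (hm : Measurable h) (hh : ∀ z, h z ∈ Set.Icc (0 : ℝ) 1) (k : ℕ) :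
    cellIntegral μ t h k ≤ cellMass μ t k := by
  have := integral_mono (μ := μ.restrict (Set.Ico (t k) (t (k + 1))))
    (integrable_of_bounded hm hh) (integrable_const (1 : ℝ)) fun z => (hh z).2
  simpa [cellMass, cellIntegral] using this

lemma integral_comp_cell_mul (ht : Monotone t) (hs : ∀ᵐ z ∂μ, z ∈ Set.Ico (t 0) (t K))
    (hK : 0 < K) (φ : ℕ → ℝ) (hi : Integrable h μ) :
    Integrable (fun z => φ (cell t K z) * h z) μ ∧
    ∫ z, φ (cell t K z) * h z ∂μ = ∑ k ∈ Finset.range K, φ k * cellIntegral μ t h k := by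
  have hint : Integrable (fun z => φ (cell t K z) * h z) μ := by
    refine hi.bdd_mul (c := ∑ k ∈ Finset.range K, |φ k|)
      ((Measurable.of_discrete (f := φ)).comp measurable_cell).aestronglyMeasurable
      (.of_forall fun z => ?_)
    exact Finset.single_le_sum (f := fun k => |φ k|) (fun k _ => abs_nonneg _)
      (Finset.mem_range.2 (cell_lt hK z))
  refine ⟨hint, ?_⟩
  have e := sum_cellIntegral ht hint (Nat.zero_le K)
  rw [Measure.restrict_eq_self_of_ae_mem hs] at e
  rw [← e, Nat.Ico_zero_eq_range]
  refine Finset.sum_congr rfl fun k hk => ?_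
  rw [cellIntegral, cellIntegral, ← integral_const_mul]
  refine setIntegral_congr_fun measurableSet_Ico fun z hz => ?_
  simp only [cell_eq ht (Finset.mem_range.1 hk) hz]

lemma integral_comp_cell (ht : Monotone t) (hs : ∀ᵐ z ∂μ, z ∈ Set.Ico (t 0) (t K))
    (hK : 0 < K) (φ : ℕ → ℝ) :
    Integrable (fun z => φ (cell t K z)) μ ∧
    ∫ z, φ (cell t K z) ∂μ = ∑ k ∈ Finset.range K, φ k * cellMass μ t k := by
  have := integral_comp_cell_mul ht hs hK φ (integrable_const (1 : ℝ))
  simpa [cellIntegral, cellMass] using this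

/-- The null cells are countably many, so together they carry no mass; for almost every value the
conditional law of its cell makes sense. -/
lemma ae_cellMass_pos (ht : Monotone t) (hs : ∀ᵐ z ∂μ, z ∈ Set.Ico (t 0) (t K)) :
    ∀ᵐ z ∂μ, 0 < cellMass μ t (cell t K z) := by
  have h0 : ∀ k, cellMass μ t k = 0 → ∀ᵐ z ∂μ, z ∉ Set.Ico (t k) (t (k + 1)) := by
    intro k hk
    rw [cellMass, measureReal_eq_zero_iff] at hk
    exact measure_eq_zero_iff_ae_notMem.1 hk
  have h1 : ∀ᵐ z ∂μ, ∀ k, cellMass μ t k = 0 → z ∉ Set.Ico (t k) (t (k + 1)) := by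
    rw [ae_all_iff]
    intro k
    by_cases hk : cellMass μ t k = 0
    · simpa [hk] using h0 k hk
    · simp [hk]
  filter_upwards [h1, hs] with z hz hz'
  exact measureReal_nonneg.lt_of_ne fun h => hz _ h.symm (mem_cell ht hz')

end

/-! ### Conditional draws -/

variable {n : ℕ}

/-- The value in an answer of the distribution oracle, with `0` in place of a failure message. -/
def drawValue : Unit ⊕ ℝ → ℝ := Sum.elim (fun _ => 0) id

lemma measurable_drawValue : Measurable drawValue :=
  measurable_const.sumElim measurable_id

/-- The law of the value in the answer of the distribution oracle. -/
def drawLaw (F : Fin n → Measure ℝ) (r : Fin n × ℝ × ℝ) : Measure ℝ :=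
  (sampleLaw F r).map drawValue

section

variable {F : Fin n → Measure ℝ} [∀ i, IsProbabilityMeasure (F i)]

instance (r : Fin n × ℝ × ℝ) : IsProbabilityMeasure (sampleLaw F r) :=
  Implements.isProbabilityMeasure_sampleLaw F r

instance (r : Fin n × ℝ × ℝ) : IsProbabilityMeasure (drawLaw F r) :=
  Measure.isProbabilityMeasure_map measurable_drawValue.aemeasurable

lemma measurable_drawLaw : Measurable (drawLaw F) :=
  (Measure.measurable_map _ measurable_drawValue).comp (measurable_sampleLaw F)

lemma sampleLaw_of_zero {i : Fin n} {a b : ℝ} (h : F i (Set.Ico a b) = 0) :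
    sampleLaw F (i, a, b) = Measure.dirac (Sum.inl ()) := by
  rw [sampleLaw, if_pos h]

lemma sampleLaw_of_pos {i : Fin n} {a b : ℝ} (h : F i (Set.Ico a b) ≠ 0) :
    sampleLaw F (i, a, b) = ((F i)[|Set.Ico a b]).map Sum.inr := by
  rw [sampleLaw, if_neg h]

lemma drawLaw_of_pos {i : Fin n} {a b : ℝ} (h : F i (Set.Ico a b) ≠ 0) :
    drawLaw F (i, a, b) = (F i)[|Set.Ico a b] := by
  rw [drawLaw, sampleLaw_of_pos h, Measure.map_map measurable_drawValue measurable_inr]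
  exact Measure.map_id

lemma drawLaw_of_full {i : Fin n} {a b : ℝ} (h : ∀ᵐ z ∂F i, z ∈ Set.Ico a b) :
    drawLaw F (i, a, b) = F i := by
  have h1 : F i (Set.Ico a b) = 1 := (prob_compl_eq_zero_iff measurableSet_Ico).1 h
  rw [drawLaw_of_pos (by simp [h1]), ProbabilityTheory.cond, h1, inv_one, one_smul,
    Measure.restrict_eq_self_of_ae_mem h]

/-- The default `0` for a failed draw is itself a legal valuation. Hence replaced profiles stay in
the box at every report, even when the chosen block is null. -/
lemma drawLaw_support {vmax : ℝ} (hv : 0 ≤ vmax) {i : Fin n}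
    (hF : ∀ᵐ z ∂F i, z ∈ Set.Icc 0 vmax) (a b : ℝ) :
    ∀ᵐ z ∂drawLaw F (i, a, b), z ∈ Set.Icc 0 vmax := by
  by_cases h : F i (Set.Ico a b) = 0
  · rw [drawLaw, sampleLaw_of_zero h, Measure.map_dirac' measurable_drawValue,
      ae_dirac_iff (p := fun z => z ∈ Set.Icc 0 vmax) measurableSet_Icc]
    exact ⟨le_rfl, hv⟩
  · rw [drawLaw_of_pos h]
    exact ProbabilityTheory.cond_absolutelyContinuous.ae_le hF

lemma integral_cond_Ico {μ : Measure ℝ} [IsProbabilityMeasure μ] {h : ℝ → ℝ} (a b : ℝ) :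
    ∫ z, h z ∂μ[|Set.Ico a b] = (∫ z in Set.Ico a b, h z ∂μ) / μ.real (Set.Ico a b) := by
  rw [ProbabilityTheory.cond, integral_smul_measure, ENNReal.toReal_inv, smul_eq_mul, div_eq_inv_mul]
  rfl

lemma integral_drawLaw {t : ℕ → ℝ} (ht : Monotone t) {h : ℝ → ℝ} (hm : Measurable h)
    (hh : ∀ z, h z ∈ Set.Icc (0 : ℝ) 1) {i : Fin n} {a b : ℕ} (hab : a ≤ b)
    (hpos : 0 < ∑ k ∈ Finset.Ico a b, cellMass (F i) t k) :
    ∫ z, h z ∂drawLaw F (i, t a, t b) =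
      blockAvg (cellMass (F i) t) (cellIntegral (F i) t h) a b := by
  rw [sum_cellMass ht hab] at hpos
  have h0 : F i (Set.Ico (t a) (t b)) ≠ 0 := fun h0 => by
    simp [measureReal_def, h0] at hpos
  rw [drawLaw_of_pos h0, integral_cond_Ico, blockAvg, sum_cellMass ht hab,
    sum_cellIntegral ht (integrable_of_bounded hm hh) hab]

end

/-! ### Replacing a valuation by a draw from its block -/

section

variable {D : Type*} [MeasurableSpace D]

/-- The law of the replacement of the valuation `z` of agent `i` by a draw from its block, when
the partition into blocks depends on data with law `ρ`. -/
def replaceLaw (F : Fin n → Measure ℝ) (t : ℕ → ℝ) (K : ℕ) (i : Fin n) (ρ : Measure D)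
    (J : D → ℕ → ℕ × ℕ) (z : ℝ) : Measure ℝ :=
  ρ.bind fun d => drawLaw F (i, t (J d (cell t K z)).1, t (J d (cell t K z)).2)

variable [DiscreteMeasurableSpace D] [Countable D] {F : Fin n → Measure ℝ}
  [∀ i, IsProbabilityMeasure (F i)] {t : ℕ → ℝ} {K : ℕ} {i : Fin n} {ρ : Measure D}
  [IsProbabilityMeasure ρ] {J : D → ℕ → ℕ × ℕ}

lemma measurable_block_request (t : ℕ → ℝ) (K : ℕ) (i : Fin n) (J : D → ℕ → ℕ × ℕ) :
    Measurable fun p : D × ℝ => (i, t (J p.1 (cell t K p.2)).1, t (J p.1 (cell t K p.2)).2) :=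
  (Measurable.of_discrete (f := fun q : D × ℕ => (i, t (J q.1 q.2).1, t (J q.1 q.2).2))).comp
    (measurable_fst.prodMk (measurable_cell.comp measurable_snd))

lemma measurable_replaceLaw : Measurable (replaceLaw F t K i ρ J) := by
  let k : Kernel (D × ℝ) ℝ := ⟨_, (measurable_drawLaw (F := F)).comp (measurable_block_request t K i J)⟩
  have : IsMarkovKernel k := ⟨fun p => inferInstanceAs (IsProbabilityMeasure (drawLaw F _))⟩
  have e : replaceLaw F t K i ρ J = ⇑(k ∘ₖ (Kernel.const ℝ ρ ×ₖ Kernel.id)) := by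
    funext z
    rw [Kernel.comp_apply, Kernel.prod_apply, Kernel.id_apply, Kernel.const_apply,
      Measure.prod_dirac, ← Measure.bind_dirac_eq_map _ (by fun_prop),
      Measure.bind_bind (by fun_prop) (by fun_prop)]
    unfold replaceLaw
    congr 1
    funext d
    rw [Measure.dirac_bind (Kernel.measurable _)]
    rfl
  rw [e]
  exact Kernel.measurable _

lemma isProbabilityMeasure_replaceLaw (z : ℝ) :
    IsProbabilityMeasure (replaceLaw F t K i ρ J z) :=
  isProbabilityMeasure_bind (Measurable.of_discrete).aemeasurable
    (.of_forall fun _ => inferInstance)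

lemma integral_replaceLaw {h : ℝ → ℝ} (hm : Measurable h) (hh : ∀ z, h z ∈ Set.Icc (0 : ℝ) 1)
    (z : ℝ) : ∫ u, h u ∂replaceLaw F t K i ρ J z =
      ∫ d, ∫ u, h u ∂drawLaw F (i, t (J d (cell t K z)).1, t (J d (cell t K z)).2) ∂ρ :=
  integral_bind_of_bounded Measurable.of_discrete (fun _ => inferInstance) hm hh

lemma replaceLaw_support {vmax : ℝ} (hv : 0 ≤ vmax) (hF : ∀ᵐ z ∂F i, z ∈ Set.Icc 0 vmax) (z : ℝ) :
    ∀ᵐ u ∂replaceLaw F t K i ρ J z, u ∈ Set.Icc 0 vmax := by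
  change replaceLaw F t K i ρ J z (Set.Icc 0 vmax)ᶜ = 0
  rw [replaceLaw, Measure.bind_apply measurableSet_Icc.compl
    Measurable.of_discrete.aemeasurable]
  have : ∀ d, drawLaw F (i, t (J d (cell t K z)).1, t (J d (cell t K z)).2)
      (Set.Icc 0 vmax)ᶜ = 0 := fun d => drawLaw_support hv hF _ _
  simp [this]

variable {h : ℝ → ℝ}

lemma blockAvg_mem (hm : Measurable h) (hh : ∀ z, h z ∈ Set.Icc (0 : ℝ) 1) (a b : ℕ) :
    blockAvg (cellMass (F i) t) (cellIntegral (F i) t h) a b ∈ Set.Icc (0 : ℝ) 1 :=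
  ⟨blockAvg_nonneg (cellIntegral_nonneg hh) (cellIntegral_le hm hh) a b,
    blockAvg_le_one (cellIntegral_nonneg hh) (cellIntegral_le hm hh) a b⟩

/-- Almost every value lies in a cell of positive mass, and then its block has positive mass for
every outcome of the data, good or bad. -/
lemma integral_replaceLaw_ae (ht : Monotone t) (hK : 0 < K)
    (hs : ∀ᵐ z ∂F i, z ∈ Set.Ico (t 0) (t K)) (hJ : ∀ d, IsBlockMap K (J d))
    (hm : Measurable h) (hh : ∀ z, h z ∈ Set.Icc (0 : ℝ) 1) :
    ∀ᵐ z ∂F i, ∫ u, h u ∂replaceLaw F t K i ρ J z =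
      ∫ d, blockAvg (cellMass (F i) t) (cellIntegral (F i) t h) (J d (cell t K z)).1
        (J d (cell t K z)).2 ∂ρ := by
  filter_upwards [ae_cellMass_pos ht hs] with z hz
  rw [integral_replaceLaw hm hh]
  refine integral_congr_ae (.of_forall fun d => ?_)
  obtain ⟨h1, h2, -, -⟩ := hJ d _ (cell_lt hK z)
  refine integral_drawLaw ht hm hh (h1.trans h2.le) (hz.trans_le ?_)
  exact Finset.single_le_sum (f := cellMass (F i) t) (fun k _ => measureReal_nonneg)
    (Finset.mem_Ico.2 ⟨h1, h2⟩)

/-- For fixed data, averaging over blocks preserves the total; the data do not depend on the report,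
so this survives averaging over them. -/
lemma integral_integral_replaceLaw (ht : Monotone t) (hK : 0 < K)
    (hs : ∀ᵐ z ∂F i, z ∈ Set.Ico (t 0) (t K)) (hJ : ∀ d, IsBlockMap K (J d))
    (hm : Measurable h) (hh : ∀ z, h z ∈ Set.Icc (0 : ℝ) 1) :
    ∫ z, ∫ u, h u ∂replaceLaw F t K i ρ J z ∂F i = ∫ z, h z ∂F i := by
  rw [integral_congr_ae (integral_replaceLaw_ae ht hK hs hJ hm hh),
    (integral_comp_cell ht hs hK fun k => ∫ d, blockAvg (cellMass (F i) t)
      (cellIntegral (F i) t h) (J d k).1 (J d k).2 ∂ρ).2]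
  have hi : ∀ k, Integrable (fun d => cellMass (F i) t k * blockAvg (cellMass (F i) t)
      (cellIntegral (F i) t h) (J d k).1 (J d k).2) ρ := fun k =>
    (integrable_of_bounded .of_discrete fun d => blockAvg_mem hm hh _ _).const_mul _
  simp_rw [mul_comm _ (cellMass (F i) t _), ← integral_const_mul]
  rw [← integral_finsetSum _ fun k _ => hi k]
  have e : ∀ d, ∑ k ∈ Finset.range K, cellMass (F i) t k * blockAvg (cellMass (F i) t)
      (cellIntegral (F i) t h) (J d k).1 (J d k).2 = ∫ z, h z ∂F i := by
    intro d
    rw [← Nat.Ico_zero_eq_range, sum_mul_blockAvg_eq (cellIntegral_nonneg hh)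
      (cellIntegral_le hm hh) (hJ d) fun _ _ _ => Nat.zero_le _,
      sum_cellIntegral ht (integrable_of_bounded hm hh) (Nat.zero_le K),
      Measure.restrict_eq_self_of_ae_mem hs]
  simp [e]

/-- Replacing a valuation by a draw from its block preserves the distribution. -/
lemma bind_replaceLaw (ht : Monotone t) (hK : 0 < K)
    (hs : ∀ᵐ z ∂F i, z ∈ Set.Ico (t 0) (t K)) (hJ : ∀ d, IsBlockMap K (J d)) :
    (F i).bind (replaceLaw F t K i ρ J) = F i := by
  have hp := isProbabilityMeasure_replaceLaw (F := F) (t := t) (K := K) (i := i) (ρ := ρ) (J := J)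
  have : IsProbabilityMeasure ((F i).bind (replaceLaw F t K i ρ J)) :=
    isProbabilityMeasure_bind measurable_replaceLaw.aemeasurable (.of_forall hp)
  refine Measure.ext fun B hB => ?_
  rw [← measureReal_eq_measureReal_iff]
  have hm : Measurable (B.indicator fun _ => (1 : ℝ)) := measurable_const.indicator hB
  have hh : ∀ z, B.indicator (fun _ => (1 : ℝ)) z ∈ Set.Icc (0 : ℝ) 1 := fun z => by
    by_cases hz : z ∈ B <;> simp [hz]
  have := integral_integral_replaceLaw (ρ := ρ) ht hK hs hJ hm hh
  rw [← integral_bind_of_bounded measurable_replaceLaw hp hm hh] at this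
  simpa [integral_indicator_const _ hB] using this

/-- Almost monotone block averages give an almost monotone interim allocation. -/
lemma integral_replaceLaw_le (ht : Monotone t) (hK : 0 < K)
    (hJ : ∀ d, IsBlockMap K (J d)) (hm : Measurable h) (hh : ∀ z, h z ∈ Set.Icc (0 : ℝ) 1)
    {s q : ℝ} (hs0 : 0 ≤ s) (E : Set D) (hE : ρ.real Eᶜ ≤ q)
    (hpos : ∀ d ∈ E, ∀ k < K, 0 < ∑ j ∈ Finset.Ico (J d k).1 (J d k).2, cellMass (F i) t j)
    (hM : ∀ d ∈ E, ∀ k k', k ≤ k' → k' < K →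
      blockAvg (cellMass (F i) t) (cellIntegral (F i) t h) (J d k).1 (J d k).2 ≤
        blockAvg (cellMass (F i) t) (cellIntegral (F i) t h) (J d k').1 (J d k').2 + s)
    {z z' : ℝ} (hz : z ≤ z') :
    ∫ u, h u ∂replaceLaw F t K i ρ J z ≤ ∫ u, h u ∂replaceLaw F t K i ρ J z' + (s + q) := by
  rw [integral_replaceLaw hm hh, integral_replaceLaw hm hh]
  set ψ : D → ℝ → ℝ := fun d z =>
    ∫ u, h u ∂drawLaw F (i, t (J d (cell t K z)).1, t (J d (cell t K z)).2) with hψ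
  have hψm : ∀ d z, ψ d z ∈ Set.Icc (0 : ℝ) 1 := fun d z => integral_mem_unitInterval hh
  have hψi : ∀ z, Integrable (fun d => ψ d z) ρ := fun z =>
    integrable_of_bounded .of_discrete fun d => hψm d z
  have hEi : Integrable (Eᶜ.indicator fun _ => (1 : ℝ)) ρ :=
    (integrable_const _).indicator .of_discrete
  -- On exceptional data the trivial bound by one is used. On `E` all blocks have positive mass, so
  -- the formula for the average holds at every report and not merely almost everywhere.
  have key : ∀ d, ψ d z ≤ ψ d z' + s + Eᶜ.indicator (fun _ => (1 : ℝ)) d := by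
    intro d
    by_cases hd : d ∈ E
    · have e : ∀ z, ψ d z = blockAvg (cellMass (F i) t) (cellIntegral (F i) t h)
          (J d (cell t K z)).1 (J d (cell t K z)).2 := fun z => by
        obtain ⟨h1, h2, -, -⟩ := hJ d _ (cell_lt hK z)
        exact integral_drawLaw ht hm hh (h1.trans h2.le) (hpos d hd _ (cell_lt hK z))
      rw [e, e, Set.indicator_of_notMem (by simpa using hd), add_zero]
      exact hM d hd _ _ (cell_mono hz) (cell_lt hK z')
    · rw [Set.indicator_of_mem (by simpa using hd)]
      linarith [(hψm d z).2, (hψm d z').1]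
  have := integral_mono (hψi z) (((hψi z').add (integrable_const s)).add hEi) key
  rw [integral_add' ((hψi z').add (integrable_const s)) hEi, integral_add' (hψi z')
    (integrable_const s), integral_indicator_const _ .of_discrete] at this
  simp only [integral_const, probReal_univ, smul_eq_mul, one_mul, mul_one] at this
  linarith

/-- The expected welfare that is lost by the replacement. -/
lemma integral_mul_le_replaced (ht : Monotone t) (ht0 : t 0 = 0) (hK : 0 < K)
    (hs : ∀ᵐ z ∂F i, z ∈ Set.Ico (t 0) (t K)) (hJ : ∀ d, IsBlockMap K (J d))
    (hm : Measurable h) (hh : ∀ z, h z ∈ Set.Icc (0 : ℝ) 1)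
    {θ η : ℝ} (hθ : t 1 ≤ θ) (hη : 0 ≤ η) (hstep : ∀ k, 1 ≤ k → t (k + 1) ≤ (1 + η) * t k)
    {s q : ℝ} (hs0 : 0 ≤ s) (E : Set D) (hE : ρ.real Eᶜ ≤ q)
    (hW : ∀ d ∈ E, ∀ k < K, ∀ c, (J d k).1 ≤ c → c < (J d k).2 →
      blockAvg (cellMass (F i) t) (cellIntegral (F i) t h) c (J d k).2 ≤
        blockAvg (cellMass (F i) t) (cellIntegral (F i) t h) (J d k).1 (J d k).2 + s) :
    ∫ z, z * h z ∂F i ≤ θ + (1 + η) * (∫ z, z * ∫ u, h u ∂replaceLaw F t K i ρ J z ∂F i +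
      (s + q) * ∫ z, z ∂F i) := by
  set f := cellMass (F i) t
  set G := cellIntegral (F i) t h
  have hG0 : ∀ k, 0 ≤ G k := cellIntegral_nonneg hh
  have hGf : ∀ k, G k ≤ f k := cellIntegral_le hm hh
  have hf0 : ∀ k, 0 ≤ f k := fun k => measureReal_nonneg
  have htn : ∀ k, 0 ≤ t k := fun k => ht0 ▸ ht (Nat.zero_le k)
  have hθ0 : 0 ≤ θ := (htn 1).trans hθ
  set a : ℕ → ℝ := fun k => ∫ d, blockAvg f G (J d k).1 (J d k).2 ∂ρ with ha
  have hi1 : Integrable (fun z : ℝ => z) (F i) :=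
    .of_mem_Icc (t 0) (t K) measurable_id.aemeasurable (hs.mono fun z hz => ⟨hz.1, hz.2.le⟩)
  have hhi := integrable_of_bounded (μ := F i) hm hh
  have hx : Measurable fun z => ∫ u, h u ∂replaceLaw F t K i ρ J z :=
    measurable_integral_of_measurable measurable_replaceLaw isProbabilityMeasure_replaceLaw hm
  have hxm : ∀ z, ∫ u, h u ∂replaceLaw F t K i ρ J z ∈ Set.Icc (0 : ℝ) 1 := fun z =>
    have := isProbabilityMeasure_replaceLaw (F := F) (t := t) (K := K) (i := i) (ρ := ρ) (J := J) z
    integral_mem_unitInterval hh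
  have hprod : ∀ g : ℝ → ℝ, Measurable g → (∀ z, g z ∈ Set.Icc (0 : ℝ) 1) →
      Integrable (fun z => z * g z) (F i) := fun g hg hg' =>
    hi1.mul_bdd (c := 1) hg.aestronglyMeasurable (.of_forall fun z => by
      rw [Real.norm_of_nonneg (hg' z).1]; exact (hg' z).2)
  -- Rounding values down to the grid costs at most `θ` in the first cell and a factor `1 + η` in
  -- the others.
  have u1 : ∫ z, z * h z ∂F i ≤ θ + (1 + η) * ∑ k ∈ Finset.range K, t k * G k := by
    obtain ⟨i1, e1⟩ := integral_comp_cell_mul ht hs hK t hhi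
    rw [← e1, ← integral_const_mul]
    have : θ = ∫ _, θ ∂F i := by simp
    rw [this, ← integral_add (integrable_const θ) (i1.const_mul _)]
    refine integral_mono_ae (hprod h hm hh) ((integrable_const θ).add (i1.const_mul _)) ?_
    filter_upwards [hs] with z hz
    have hz' := mem_cell ht hz
    have hh1 := hh z
    have : z ≤ θ ∨ z ≤ (1 + η) * t (cell t K z) := by
      rcases Nat.eq_zero_or_pos (cell t K z) with h0 | h0
      · left
        rw [h0] at hz'
        exact hz'.2.le.trans hθ
      · exact .inr (hz'.2.le.trans (hstep _ h0))
    have h2 : 0 ≤ (1 + η) * t (cell t K z) := mul_nonneg (by linarith) (htn _)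
    rcases this with h3 | h3
    · nlinarith [mul_le_mul_of_nonneg_right h3 hh1.1, mul_nonneg h2 hh1.1,
        mul_le_mul_of_nonneg_left hh1.2 hθ0]
    · nlinarith [mul_le_mul_of_nonneg_right h3 hh1.1]
  have u2 : ∑ k ∈ Finset.range K, t k * (f k * a k) ≤
      ∫ z, z * ∫ u, h u ∂replaceLaw F t K i ρ J z ∂F i := by
    obtain ⟨i1, e1⟩ := integral_comp_cell (μ := F i) ht hs hK fun k => t k * a k
    rw [show ∑ k ∈ Finset.range K, t k * (f k * a k) = ∑ k ∈ Finset.range K, t k * a k * f k from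
      Finset.sum_congr rfl fun k _ => by ring, ← e1]
    refine integral_mono_ae i1 (hprod _ hx hxm) ?_
    filter_upwards [hs, integral_replaceLaw_ae (ρ := ρ) ht hK hs hJ hm hh] with z hz hz'
    have h4 : a (cell t K z) = ∫ u, h u ∂replaceLaw F t K i ρ J z := hz'.symm
    change t (cell t K z) * a (cell t K z) ≤ _
    rw [h4]
    exact mul_le_mul_of_nonneg_right (mem_cell ht hz).1 (hxm z).1
  have u3 : ∑ k ∈ Finset.range K, t k * f k ≤ ∫ z, z ∂F i := by
    obtain ⟨i1, e1⟩ := integral_comp_cell (μ := F i) ht hs hK t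
    rw [← e1]
    refine integral_mono_ae i1 hi1 ?_
    filter_upwards [hs] with z hz using (mem_cell ht hz).1
  have hT0 : 0 ≤ ∑ k ∈ Finset.range K, t k * f k :=
    Finset.sum_nonneg fun k _ => mul_nonneg (htn k) (hf0 k)
  -- Ironing loses the fraction `s` of the total weighted mass on `E`, and at most all of it on the
  -- complement.
  have u4 : ∑ k ∈ Finset.range K, t k * G k ≤
      ∑ k ∈ Finset.range K, t k * (f k * a k) + (s + q) * ∑ k ∈ Finset.range K, t k * f k := by
    set T := ∑ k ∈ Finset.range K, t k * f k
    have hint : ∀ k, Integrable (fun d => t k * (f k * blockAvg f G (J d k).1 (J d k).2)) ρ :=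
      fun k => ((integrable_of_bounded .of_discrete
        fun d => blockAvg_mem hm hh _ _).const_mul _).const_mul _
    have hsum : ∑ k ∈ Finset.range K, t k * (f k * a k) =
        ∫ d, ∑ k ∈ Finset.range K, t k * (f k * blockAvg f G (J d k).1 (J d k).2) ∂ρ := by
      rw [integral_finsetSum _ fun k _ => hint k]
      simp only [ha, integral_const_mul]
    have hEi : Integrable (Eᶜ.indicator fun _ => T) ρ := (integrable_const _).indicator .of_discrete
    have key : ∀ d, ∑ k ∈ Finset.range K, t k * G k ≤
        ∑ k ∈ Finset.range K, t k * (f k * blockAvg f G (J d k).1 (J d k).2) +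
          (s * T + Eᶜ.indicator (fun _ => T) d) := by
      intro d
      by_cases hd : d ∈ E
      · rw [Set.indicator_of_notMem (by simpa using hd), add_zero]
        exact sum_mul_le_ironed hG0 hGf ht (htn 0) (hJ d) hs0 (hW d hd)
      · rw [Set.indicator_of_mem (by simpa using hd)]
        have h5 : ∑ k ∈ Finset.range K, t k * G k ≤ T :=
          Finset.sum_le_sum fun k _ => mul_le_mul_of_nonneg_left (hGf k) (htn k)
        have h6 : 0 ≤ ∑ k ∈ Finset.range K, t k * (f k * blockAvg f G (J d k).1 (J d k).2) :=
          Finset.sum_nonneg fun k _ => mul_nonneg (htn k)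
            (mul_nonneg (hf0 k) (blockAvg_nonneg hG0 hGf _ _))
        nlinarith [mul_nonneg hs0 hT0]
    have hsi : Integrable (fun d => ∑ k ∈ Finset.range K,
        t k * (f k * blockAvg f G (J d k).1 (J d k).2)) ρ := integrable_finsetSum _ fun k _ => hint k
    have := integral_mono (integrable_const _) (hsi.add ((integrable_const (s * T)).add hEi)) key
    rw [integral_add' hsi ((integrable_const _).add hEi), integral_add' (integrable_const _) hEi,
      integral_indicator_const _ .of_discrete, ← hsum] at this
    simp only [integral_const, probReal_univ, smul_eq_mul, one_mul] at this
    nlinarith [mul_le_mul_of_nonneg_right hE hT0]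
  have hq0 : 0 ≤ q := measureReal_nonneg.trans hE
  have u5 := mul_le_mul_of_nonneg_left u3 (add_nonneg hs0 hq0)
  refine u1.trans (add_le_add_right (mul_le_mul_of_nonneg_left ?_ (by linarith)) _)
  linarith

end

end OracleReduction
end

noncomputable section

namespace OracleReduction

variable {n : ℕ}

/-! ### Interim allocations and welfare -/

/-- The probability that the algorithm serves agent `i` at a profile. -/
def serveProb (B : Algorithm n) (i : Fin n) (v : Profile n) : ℝ :=
  (B v).real {S | i ∈ S}

section

variable {B : Algorithm n} [IsMarkovKernel B] {F : Fin n → Measure ℝ}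
  [∀ i, IsProbabilityMeasure (F i)]

lemma serveProb_mem (i : Fin n) (v : Profile n) : serveProb B i v ∈ Set.Icc (0 : ℝ) 1 :=
  ⟨measureReal_nonneg, measureReal_le_one⟩

lemma measurable_serveProb (i : Fin n) : Measurable (serveProb B i) :=
  (Kernel.measurable_coe B (measurableSet_mem i)).ennreal_toReal

lemma interimAlloc_eq (i : Fin n) (z : ℝ) :
    interimAlloc F B i z = ∫ v, serveProb B i (Function.update v i z) ∂Measure.pi F := rfl

lemma interimAlloc_mem (i : Fin n) (z : ℝ) : interimAlloc F B i z ∈ Set.Icc (0 : ℝ) 1 :=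
  integral_mem_unitInterval fun _ => serveProb_mem i _

lemma measurable_interimAlloc (i : Fin n) : Measurable (interimAlloc F B i) := by
  have : Measurable (Function.uncurry fun (z : ℝ) (v : Profile n) =>
      serveProb B i (Function.update v i z)) :=
    (measurable_serveProb i).comp (measurable_update_uncurry i)
  exact (this.stronglyMeasurable.integral_prod_right (ν := Measure.pi F)).measurable

lemma measureReal_bind {X Y : Type*} [MeasurableSpace X] [MeasurableSpace Y] {μ : Measure X}
    [IsProbabilityMeasure μ] {κ : X → Measure Y} (hκ : Measurable κ)
    (hp : ∀ x, IsProbabilityMeasure (κ x)) {s : Set Y} (hs : MeasurableSet s) :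
    (μ.bind κ).real s = ∫ x, (κ x).real s ∂μ := by
  have := integral_bind_of_bounded (μ := μ) hκ hp (h := s.indicator fun _ => (1 : ℝ))
    (measurable_const.indicator hs) (a := 0) (b := 1) fun z => by
      by_cases hz : z ∈ s <;> simp [hz]
  simpa [integral_indicator_const _ hs] using this

/-- If each reported value is first replaced by a random value with the same distribution, then
the interim allocation at a report is the average of the original one over the replacements. -/
lemma interimAlloc_replaced {τ : Fin n → ℝ → Measure ℝ} (hτ : ∀ i, Measurable (τ i))
    (hp : ∀ i z, IsProbabilityMeasure (τ i z)) (hF : ∀ i, (F i).bind (τ i) = F i)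
    {R : Algorithm n} [IsMarkovKernel R]
    (hR : ∀ v, R v = (Measure.pi fun i => τ i (v i)).bind B) (i : Fin n) (z : ℝ) :
    interimAlloc F R i z = ∫ w, interimAlloc F B i w ∂τ i z := by
  have hupd := (measurable_update_uncurry (Y := ℝ) i).of_uncurry_left (x := z)
  have hm : Measurable fun v : Profile n => Measure.pi fun j => τ j (v j) :=
    measurable_pi_measure (fun j => (hτ j).comp (measurable_pi_apply j)) fun j v => hp j _
  have hs : ∀ v, serveProb R i v = ∫ u, serveProb B i u ∂Measure.pi fun j => τ j (v j) := fun v => by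
    rw [serveProb, hR, measureReal_bind B.measurable (fun _ => inferInstance) (measurableSet_mem i)]
    rfl
  -- A fixed report is a product measure with a point mass in coordinate `i`. After the replacement
  -- the other factors are again `F j`, and the point mass has become `τ i z`.
  have hpu := isProbabilityMeasure_update (μ := F) i (Measure.dirac z)
  have e : interimAlloc F R i z =
      ∫ v, serveProb R i v ∂Measure.pi (Function.update F i (Measure.dirac z)) := by
    rw [interimAlloc_eq, ← map_update_pi, integral_map hupd.aemeasurable
      (measurable_serveProb i).aestronglyMeasurable]
  rw [e]
  simp only [hs]
  rw [← integral_bind_of_bounded hm (fun v => inferInstance) (measurable_serveProb i)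
    (serveProb_mem i), pi_bind_pi hτ hp]
  have e2 : (fun j => (Function.update F i (Measure.dirac z) j).bind (τ j)) =
      Function.update F i (τ i z) := by
    funext j
    rcases eq_or_ne j i with rfl | h
    · simp [Measure.dirac_bind (hτ j)]
    · simp [h, hF]
  have := hp i z
  rw [e2, integral_pi_update i _ (measurable_serveProb i) (serveProb_mem i)]
  rfl

lemma integrable_welfare (v : Profile n) {X : Type*} [MeasurableSpace X] {μ : Measure X}
    [IsFiniteMeasure μ] {f : X → Allocation n} (hf : Measurable f) :
    Integrable (fun x => welfare v (f x)) μ :=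
  (integrable_of_bounded (μ := μ.map f) (h := welfare v) (a := ⨅ S, welfare v S)
    (b := ⨆ S, welfare v S) .of_discrete fun S =>
    ⟨ciInf_le (Set.finite_range _).bddBelow S, le_ciSup (Set.finite_range _).bddAbove S⟩).comp_measurable
    hf

lemma integral_welfare (v : Profile n) :
    ∫ S, welfare v S ∂B v = ∑ i, v i * serveProb B i v := by
  have e : ∀ i (S : Allocation n), S.indicator v i =
      {S : Allocation n | i ∈ S}.indicator (fun _ => v i) S := fun i S => by
    by_cases h : i ∈ S <;> simp [h]
  unfold welfare
  simp only [e]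
  rw [integral_finsetSum _ fun i _ =>
    (integrable_const (v i)).indicator (measurableSet_mem i)]
  refine Finset.sum_congr rfl fun i _ => ?_
  rw [integral_indicator_const _ (measurableSet_mem i), smul_eq_mul, mul_comm]
  rfl

variable {vmax : ℝ}

lemma ae_mem_valuationBox (hF : ∀ i, ∀ᵐ z ∂F i, z ∈ Set.Icc 0 vmax) :
    ∀ᵐ v ∂Measure.pi F, v ∈ valuationBox n vmax := by
  refine ae_all_iff.2 fun i => ?_
  exact (measurePreserving_eval F i).quasiMeasurePreserving.ae (hF i)

lemma integrable_mul_serveProb (hF : ∀ i, ∀ᵐ z ∂F i, z ∈ Set.Icc 0 vmax) (i : Fin n) :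
    Integrable (fun v => v i * serveProb B i v) (Measure.pi F) := by
  refine .of_mem_Icc 0 vmax ((measurable_pi_apply i).mul (measurable_serveProb i)).aemeasurable ?_
  filter_upwards [ae_mem_valuationBox hF] with v hv
  have h1 := serveProb_mem (B := B) i v
  exact ⟨mul_nonneg (hv i).1 h1.1, (mul_le_of_le_one_right (hv i).1 h1.2).trans (hv i).2⟩

lemma integrable_integral_welfare (hF : ∀ i, ∀ᵐ z ∂F i, z ∈ Set.Icc 0 vmax) :
    Integrable (fun v => ∫ S, welfare v S ∂B v) (Measure.pi F) := by
  simp only [integral_welfare]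
  exact integrable_finsetSum _ fun i _ => integrable_mul_serveProb hF i

lemma expectedWelfare_eq (hv : 0 ≤ vmax) (hF : ∀ i, ∀ᵐ z ∂F i, z ∈ Set.Icc 0 vmax) :
    expectedWelfare F B = ∑ i, ∫ z, z * interimAlloc F B i z ∂F i := by
  unfold expectedWelfare
  simp only [integral_welfare]
  rw [integral_finsetSum _ fun i _ => integrable_mul_serveProb hF i]
  refine Finset.sum_congr rfl fun i _ => ?_
  -- Truncation makes the integrand bounded everywhere, as `integral_pi_update` requires, and
  -- changes nothing almost surely.
  let φ : ℝ → ℝ := fun z => max 0 (min z vmax)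
  have hφm : Measurable φ := by fun_prop
  have hφ : ∀ z, φ z ∈ Set.Icc 0 vmax := fun z => ⟨le_max_left _ _, max_le hv (min_le_right _ _)⟩
  have hφe : ∀ z ∈ Set.Icc 0 vmax, φ z = z := fun z hz => by
    simp only [φ]
    rw [min_eq_left hz.2, max_eq_right hz.1]
  have e1 : ∫ v, v i * serveProb B i v ∂Measure.pi F =
      ∫ v, φ (v i) * serveProb B i v ∂Measure.pi F := by
    refine integral_congr_ae ?_
    filter_upwards [ae_mem_valuationBox hF] with v hv
    rw [hφe _ (hv i)]
  have e2 := integral_pi_update (μ := F) i (F i) (h := fun v => φ (v i) * serveProb B i v)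
    ((hφm.comp (measurable_pi_apply i)).mul (measurable_serveProb i)) (a := 0) (b := vmax)
    fun v => ⟨mul_nonneg (hφ _).1 (serveProb_mem i v).1,
      (mul_le_of_le_one_right (hφ _).1 (serveProb_mem i v).2).trans (hφ _).2⟩
  rw [Function.update_eq_self] at e2
  rw [e1, e2]
  refine integral_congr_ae ?_
  filter_upwards [hF i] with z hz
  simp only [Function.update_self]
  rw [integral_const_mul, hφe z hz]
  rfl

lemma expectedWelfare_nonneg (hF : ∀ i, ∀ᵐ z ∂F i, z ∈ Set.Icc 0 vmax) :
    0 ≤ expectedWelfare F B := by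
  refine integral_nonneg_of_ae ?_
  filter_upwards [ae_mem_valuationBox hF] with v hv
  rw [integral_welfare]
  exact Finset.sum_nonneg fun i _ => mul_nonneg (hv i).1 (serveProb_mem i v).1

/-- An almost monotone interim allocation rule is almost incentive compatible. -/
lemma isBIC_of_almost_monotone {s : ℝ} (hs : 0 ≤ s)
    (h : ∀ i z z', z ≤ z' → interimAlloc F B i z ≤ interimAlloc F B i z' + s) :
    IsBIC F vmax (s * vmax) B := by
  intro i z hz z' hz'
  set x := interimAlloc F B i
  have hx : Measurable x := measurable_interimAlloc i
  have hi : ∀ a b, IntervalIntegrable x volume a b := fun a b =>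
    ⟨integrable_of_bounded hx (interimAlloc_mem i), integrable_of_bounded hx (interimAlloc_mem i)⟩
  have e := intervalIntegral.integral_interval_sub_left (hi 0 z) (hi 0 z')
  -- With the payment formula, the incentive inequality is exactly this comparison of an integral
  -- with a rectangle; almost monotonicity costs `s` per unit length.
  have key : (z - z') * x z' - s * vmax ≤ ∫ t in z'..z, x t := by
    rcases le_total z' z with hle | hle
    · have := intervalIntegral.integral_mono_on hle (intervalIntegrable_const
        (c := x z' - s)) (hi z' z) fun t ht => by linarith [h i z' t ht.1]
      rw [intervalIntegral.integral_const, smul_eq_mul] at this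
      nlinarith [hz.1, hz.2, hz'.1, hz'.2, mul_le_mul_of_nonneg_left (by linarith [hz.2, hz'.1] :
        z - z' ≤ vmax) hs]
    · have := intervalIntegral.integral_mono_on hle (hi z z')
        (intervalIntegrable_const (c := x z' + s)) fun t ht => h i t z' ht.2
      rw [intervalIntegral.integral_const, smul_eq_mul] at this
      rw [intervalIntegral.integral_symm]
      nlinarith [hz.1, hz.2, hz'.1, hz'.2, mul_le_mul_of_nonneg_left (by linarith [hz'.2, hz.1] :
        z' - z ≤ vmax) hs]
  simp only [interimPayment]
  change z * x z - (z * x z - ∫ t in (0 : ℝ)..z, x t) ≥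
    z * x z' - (z' * x z' - ∫ t in (0 : ℝ)..z', x t) - s * vmax
  linarith

end

/-! ### Falling back to the agent with the highest value -/

/-- The set that consists of the first agent with the highest value. -/
def topAgent (v : Profile n) : Allocation n :=
  {i | ∀ j, v j < v i ∨ (v j ≤ v i ∧ i ≤ j)}

lemma exists_topAgent (hn : 1 ≤ n) (v : Profile n) :
    ∃ i, topAgent v = {i} ∧ ∀ j, v j ≤ v i := by
  have : Nonempty (Fin n) := ⟨⟨0, hn⟩⟩
  obtain ⟨m, hm⟩ := Finite.exists_max v
  have hne : (Finset.univ.filter fun i => ∀ j, v j ≤ v i).Nonempty := ⟨m, by simpa using hm⟩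
  obtain ⟨i, hi, hmin⟩ := Finset.exists_min_image _ id hne
  simp only [Finset.mem_filter, Finset.mem_univ, true_and, id] at hi hmin
  refine ⟨i, ?_, hi⟩
  ext k
  simp only [topAgent, Set.mem_ofPred_eq, Set.mem_singleton_iff]
  constructor
  · intro h
    have hk : ∀ j, v j ≤ v k := fun j => (h j).elim le_of_lt And.left
    refine le_antisymm ?_ (hmin k hk)
    exact (h i).elim (fun h' => absurd (hi k) (not_le.2 h')) And.right
  · rintro rfl j
    rcases lt_or_ge (v j) (v k) with h | h
    · exact .inl h
    · exact .inr ⟨hi j, hmin j fun l => (hi l).trans h⟩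

lemma measurable_topAgent : Measurable (topAgent (n := n)) := by
  refine measurable_set_iff.2 fun i => ?_
  simp only [topAgent, Set.mem_ofPred_eq]
  refine measurableSet_setOfPred.1 ?_
  change MeasurableSet {v : Profile n | ∀ j, v j < v i ∨ (v j ≤ v i ∧ i ≤ j)}
  have e : {v : Profile n | ∀ j, v j < v i ∨ (v j ≤ v i ∧ i ≤ j)} =
      ⋂ j, ({v | v j < v i} ∪ ({v | v j ≤ v i} ∩ {_v | i ≤ j})) := by
    ext v; simp
  rw [e]
  exact .iInter fun j => (measurableSet_lt (measurable_pi_apply j) (measurable_pi_apply i)).union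
    ((measurableSet_le (measurable_pi_apply j) (measurable_pi_apply i)).inter (.const _))

lemma measurable_welfare : Measurable (Function.uncurry (welfare (n := n))) := by
  unfold welfare Function.uncurry
  refine Finset.measurable_fun_sum _ fun i _ => ?_
  have e : (fun p : Profile n × Allocation n => p.2.indicator p.1 i) =
      {p : Profile n × Allocation n | i ∈ p.2}.indicator fun p => p.1 i := by
    funext p
    by_cases h : i ∈ p.2 <;> simp [h]
  rw [e]
  exact ((measurable_pi_apply i).comp measurable_fst).indicator
    ((measurableSet_mem i).preimage measurable_snd)

open Classical in
/-- The better of an allocation and serving only an agent with the highest value. -/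
def improve (v : Profile n) (S : Allocation n) : Allocation n :=
  if ∀ i, v i ≤ welfare v S then S else topAgent v

lemma measurable_improve : Measurable (Function.uncurry (improve (n := n))) := by
  classical
  unfold improve Function.uncurry
  refine Measurable.ite ?_ measurable_snd (measurable_topAgent.comp measurable_fst)
  have e : {p : Profile n × Allocation n | ∀ i, p.1 i ≤ welfare p.1 p.2} =
      ⋂ i, {p | p.1 i ≤ welfare p.1 p.2} := by
    ext p; simp
  rw [e]
  exact .iInter fun i => measurableSet_le ((measurable_pi_apply i).comp measurable_fst)
    measurable_welfare

lemma welfare_singleton (v : Profile n) (i : Fin n) : welfare v {i} = v i := by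
  unfold welfare
  rw [Finset.sum_eq_single i (fun j _ hj => by simp [hj]) (by simp)]
  simp

lemma welfare_le_improve (hn : 1 ≤ n) (v : Profile n) (S : Allocation n) :
    welfare v S ≤ welfare v (improve v S) ∧ ∀ i, v i ≤ welfare v (improve v S) := by
  unfold improve
  split_ifs with h
  · exact ⟨le_rfl, h⟩
  · obtain ⟨i, hi, hmax⟩ := exists_topAgent hn v
    rw [hi, welfare_singleton]
    push Not at h
    obtain ⟨j, hj⟩ := h
    exact ⟨hj.le.trans (hmax j), hmax⟩

/-- The algorithm that serves only an agent with the highest value whenever this is better. -/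
def improved (A : Algorithm n) : Algorithm n :=
  (Kernel.id ×ₖ A).map (Function.uncurry improve)

section

variable {A : Algorithm n} [IsMarkovKernel A]

lemma improved_apply (v : Profile n) : improved A v = (A v).map (improve v) := by
  rw [improved, Kernel.map_apply _ measurable_improve, Kernel.prod_apply, Kernel.id_apply,
    Measure.dirac_prod, Measure.map_map measurable_improve measurable_prodMk_left]
  rfl

instance : IsMarkovKernel (improved A) := Kernel.IsMarkovKernel.map _ measurable_improve

lemma improved_feasible {vmax : ℝ} {X : Set (Allocation n)} (hn : 1 ≤ n) (hX : ∀ i, {i} ∈ X)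
    (hA : IsFeasibleAlgorithm vmax X A) : IsFeasibleAlgorithm vmax X (improved A) := by
  intro v hv
  rw [improved_apply, ae_map_iff (p := fun S => S ∈ X)
    (measurable_improve.of_uncurry_left (x := v)).aemeasurable (MeasurableSet.of_discrete (s := X))]
  filter_upwards [hA v hv] with S hS
  unfold improve
  split_ifs
  · exact hS
  · obtain ⟨i, hi, -⟩ := exists_topAgent hn v
    exact hi ▸ hX i

lemma integral_welfare_improved (v : Profile n) :
    ∫ S, welfare v S ∂improved A v = ∫ S, welfare v (improve v S) ∂A v := by
  rw [improved_apply, integral_map (measurable_improve.of_uncurry_left (x := v)).aemeasurable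
    Measurable.of_discrete.aestronglyMeasurable]

variable {F : Fin n → Measure ℝ} [∀ i, IsProbabilityMeasure (F i)] {vmax : ℝ}

lemma expectedWelfare_le_improved (hn : 1 ≤ n) (hF : ∀ i, ∀ᵐ z ∂F i, z ∈ Set.Icc 0 vmax) :
    expectedWelfare F A ≤ expectedWelfare F (improved A) := by
  refine integral_mono (integrable_integral_welfare hF) (integrable_integral_welfare hF) fun v => ?_
  simp only [integral_welfare_improved]
  exact integral_mono (integrable_welfare v measurable_id)
    (integrable_welfare v (measurable_improve.of_uncurry_left (x := v)))
    fun S => (welfare_le_improve hn v S).1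

/-- At every profile the improved welfare is at least each single valuation. This turns losses
proportional to `muMax F` into relative losses. -/
lemma muMax_le_improved (hn : 1 ≤ n) (hF : ∀ i, ∀ᵐ z ∂F i, z ∈ Set.Icc 0 vmax) :
    muMax F ≤ expectedWelfare F (improved A) := by
  have : Nonempty (Fin n) := ⟨⟨0, hn⟩⟩
  refine ciSup_le fun i => ?_
  have hi : Integrable (fun z : ℝ => z) (F i) :=
    .of_mem_Icc 0 vmax measurable_id.aemeasurable (hF i)
  have hi' : Integrable (fun v : Profile n => v i) (Measure.pi F) :=
    integrable_comp_eval (μ := F) (i := i) (f := fun z : ℝ => z) hi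
  rw [← integral_comp_eval (μ := F) (i := i) hi.aestronglyMeasurable]
  refine integral_mono hi' (integrable_integral_welfare hF) fun v => ?_
  simp only [integral_welfare_improved]
  have := integral_mono (μ := A v) (integrable_const (v i))
    (integrable_welfare v (measurable_improve.of_uncurry_left (x := v)))
    fun S => (welfare_le_improve hn v S).2 i
  simpa using this

end

end OracleReduction
end

noncomputable section

namespace OracleReduction

variable {n : ℕ}

/-! ### Independent pairs of computations and calls to the improved algorithm -/

namespace Implements

variable {X Y Z : Type} [MeasurableSpace X] [MeasurableSpace Y] [MeasurableSpace Z]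
  {c s c' s' : ℕ}

lemma of_eq {κ : Algorithm n → (Fin n → Measure ℝ) → X → Measure Y} (hκ : Implements c s κ)
    (hc : c = c') (hs : s = s') : Implements c' s' κ := hc ▸ hs ▸ hκ

lemma prod {κ : Algorithm n → (Fin n → Measure ℝ) → X → Measure Y}
    {η : Algorithm n → (Fin n → Measure ℝ) → X → Measure Z}
    (hκ : Implements c s κ) (hη : Implements c' s' η) :
    Implements (c + c') (s + s') fun A F x => (κ A F x).prod (η A F x) :=
  (hκ.bind ((hη.comap (measurable_fst : Measurable (Prod.fst : X × Y → X))).map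
    (f := fun p z => (p.2, z)) (by fun_prop))).congr fun A _ F _ x => by
      rw [Measure.prod]

/-- The comparison with the top agent uses only the queried profile and the answer, so no further
call is needed. -/
lemma query_improved {v : X → Profile n} (hv : Measurable v) :
    Implements (n := n) 1 0 fun A _ x => improved A (v x) :=
  ((query hv).map (f := fun x S => improve (v x) S)
    (measurable_improve.comp ((hv.comp measurable_fst).prodMk measurable_snd))).congr
    fun _ _ _ _ x => (improved_apply (v x)).symm

end Implements

/-! ### Estimating the interim allocation rule -/

/-- The data from which the blocks are computed: for each grid cell, whether the agent was served
in each of `N` runs with a value from that cell, and for each pair of grid points, the cells of `N`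
values from the interval between them. The last index stands for a failure of the oracle. -/
abbrev Data (K N : ℕ) : Type :=
  (Fin (K + 1) → Fin N → Bool) × (Fin (K + 1) → Fin (K + 1) → Fin N → Fin (K + 1))

/-- The requests for a profile in which the value of agent `i` comes from the cell `k`. -/
def profileRequest (t : ℕ → ℝ) (K : ℕ) (i : Fin n) (k : ℕ) (j : Fin n) : Fin n × ℝ × ℝ :=
  if j = i then (i, t k, t (k + 1)) else (j, t 0, t K)

/-- The profile obtained from the answers of the distribution oracle. -/
def drawProfile (w : Fin n → Unit ⊕ ℝ) : Profile n := fun j => drawValue (w j)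

lemma measurable_drawProfile : Measurable (drawProfile (n := n)) :=
  measurable_pi_iff.2 fun j => measurable_drawValue.comp (measurable_pi_apply j)

open Classical in
/-- Whether agent `i` is served, where a failure of the oracle counts as not served. -/
def servedBit (i : Fin n) (w : Fin n → Unit ⊕ ℝ) (S : Allocation n) : Bool :=
  decide ((w i).isRight = true ∧ i ∈ S)

lemma measurable_isRight : Measurable (Sum.isRight : Unit ⊕ ℝ → Bool) :=
  measurable_fun_sum measurable_const measurable_const

lemma measurable_servedBit (i : Fin n) : Measurable (Function.uncurry (servedBit i)) := by
  refine measurable_to_bool ?_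
  have e : Function.uncurry (servedBit i) ⁻¹' {true} =
      {p | (p.1 i).isRight = true} ∩ {p | i ∈ p.2} := by
    ext p
    simp [servedBit, Function.uncurry]
  rw [e]
  refine MeasurableSet.inter ?_ ((measurableSet_mem i).preimage measurable_snd)
  exact (measurable_isRight.comp ((measurable_pi_apply i).comp measurable_fst))
    (measurableSet_singleton true)

/-- The law of a run of `B` that tests whether agent `i` is served with a value from the
cell `k`. -/
def bitLaw (B : Algorithm n) (F : Fin n → Measure ℝ) (t : ℕ → ℝ) (K : ℕ) (i : Fin n) (k : ℕ) :
    Measure Bool :=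
  (Measure.pi fun j => sampleLaw F (profileRequest t K i k j)).bind fun w =>
    (B (drawProfile w)).map (servedBit i w)

/-- The index of the cell of an answer of the distribution oracle. -/
def cellIndex (t : ℕ → ℝ) (K : ℕ) (r : Unit ⊕ ℝ) : Fin (K + 1) :=
  Fin.ofNat (K + 1) (Sum.elim (fun _ => K) (cell t K) r)

lemma measurable_cellIndex (t : ℕ → ℝ) (K : ℕ) : Measurable (cellIndex t K) :=
  (Measurable.of_discrete (f := Fin.ofNat (K + 1))).comp
    (measurable_const.sumElim measurable_cell)

/-- The law of the data. -/
def dataLaw (B : Algorithm n) (F : Fin n → Measure ℝ) (t : ℕ → ℝ) (K N : ℕ) (i : Fin n) :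
    Measure (Data K N) :=
  (Measure.pi fun k : Fin (K + 1) => Measure.pi fun _ : Fin N => bitLaw B F t K i k).prod
    (Measure.pi fun a : Fin (K + 1) => Measure.pi fun b : Fin (K + 1) =>
      Measure.pi fun _ : Fin N => (sampleLaw F (i, t a, t b)).map (cellIndex t K))

lemma implements_bitLaw (t : ℕ → ℝ) (K : ℕ) (i : Fin n) (k : ℕ) :
    Implements (n := n) (X := Unit) 1 n fun A F _ => bitLaw (improved A) F t K i k := by
  have h1 := Implements.pi (n := n) (X := Unit) fun j =>
    Implements.sample (r := fun _ : Unit => profileRequest t K i k j) measurable_const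
  have h2 := (Implements.query_improved (n := n)
    (measurable_drawProfile.comp measurable_snd : Measurable fun p : Unit × _ => drawProfile p.2)).map
    (f := fun p S => servedBit i p.2 S)
    ((measurable_servedBit i).comp ((measurable_snd.comp measurable_fst).prodMk measurable_snd))
  exact (h1.bind h2).of_eq (by simp) (by simp)

/-- Only the bits of the single cells cost calls; the quadratically many pairs of grid points cost
samples alone. -/
lemma implements_dataLaw (t : ℕ → ℝ) (K N : ℕ) (i : Fin n) :
    Implements (n := n) (X := Unit) ((K + 1) * N) ((K + 1) * (N * n) + (K + 1) * ((K + 1) * N))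
      fun A F _ => dataLaw (improved A) F t K N i := by
  have h1 := Implements.pi (m := K + 1) fun k =>
    Implements.pi (m := N) fun _ => implements_bitLaw (n := n) t K i k
  have h2 := Implements.pi (n := n) (m := K + 1) fun a => Implements.pi (m := K + 1) fun b =>
    Implements.pi (m := N) fun _ =>
      (Implements.sample (X := Unit) (r := fun _ => (i, t a, t b)) measurable_const).map
        (f := fun _ => cellIndex t K) ((measurable_cellIndex t K).comp measurable_snd)
  exact (h1.prod h2).of_eq (by simp) (by simp)

section

variable {B : Algorithm n} [IsMarkovKernel B] {F : Fin n → Measure ℝ}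
  [∀ i, IsProbabilityMeasure (F i)] {t : ℕ → ℝ} {K N : ℕ} {i : Fin n}

lemma measurable_map_servedBit (i : Fin n) : Measurable fun w : Fin n → Unit ⊕ ℝ =>
    (B (drawProfile w)).map (servedBit i w) := by
  have : (fun w : Fin n → Unit ⊕ ℝ => (B (drawProfile w)).map (servedBit i w)) =
      ⇑((Kernel.id ×ₖ B.comap drawProfile measurable_drawProfile).map
        (Function.uncurry (servedBit i))) := by
    funext w
    rw [Kernel.map_apply _ (measurable_servedBit i), Kernel.prod_apply, Kernel.id_apply,
      Measure.dirac_prod, Measure.map_map (measurable_servedBit i) measurable_prodMk_left]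
    rfl
  rw [this]
  exact Kernel.measurable _

lemma isProbabilityMeasure_map_servedBit (i : Fin n) (w : Fin n → Unit ⊕ ℝ) :
    IsProbabilityMeasure ((B (drawProfile w)).map (servedBit i w)) :=
  Measure.isProbabilityMeasure_map ((measurable_servedBit i).of_uncurry_left (x := w)).aemeasurable

instance (k : ℕ) : IsProbabilityMeasure (bitLaw B F t K i k) :=
  isProbabilityMeasure_bind (measurable_map_servedBit i).aemeasurable
    (.of_forall (isProbabilityMeasure_map_servedBit i))

instance (a b : ℝ) : IsProbabilityMeasure ((sampleLaw F (i, a, b)).map (cellIndex t K)) :=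
  Measure.isProbabilityMeasure_map (measurable_cellIndex t K).aemeasurable

instance : IsProbabilityMeasure (dataLaw B F t K N i) := by
  unfold dataLaw; infer_instance

/-- The interval `[t 0, t K)` has full probability, so a request for it returns an unconditioned
draw for each other agent. -/
lemma map_drawProfile (ht0 : ∀ j, ∀ᵐ z ∂F j, z ∈ Set.Ico (t 0) (t K)) (k : ℕ) :
    (Measure.pi fun j => sampleLaw F (profileRequest t K i k j)).map drawProfile =
      Measure.pi (Function.update F i (drawLaw F (i, t k, t (k + 1)))) := by
  have : ∀ j, IsProbabilityMeasure
      ((sampleLaw F (profileRequest t K i k j)).map drawValue) := fun j =>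
    inferInstanceAs (IsProbabilityMeasure (drawLaw F _))
  unfold drawProfile
  rw [Measure.pi_map_pi fun j => measurable_drawValue.aemeasurable]
  congr 1
  funext j
  change drawLaw F (profileRequest t K i k j) = _
  unfold profileRequest
  rcases eq_or_ne j i with rfl | h
  · simp
  · simp [h, drawLaw_of_full (ht0 j)]

/-- The indicator of `true`. -/
def boolValue (b : Bool) : ℝ := if b then 1 else 0

lemma boolValue_mem (b : Bool) : boolValue b ∈ Set.Icc (0 : ℝ) 1 := by
  cases b <;> simp [boolValue]

/-- The bits are unbiased for the cell average. For a null cell both sides vanish: a failure counts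
as not served, and the average is `0 / 0 = 0`. -/
lemma integral_bitLaw (ht : Monotone t) (ht0 : ∀ j, ∀ᵐ z ∂F j, z ∈ Set.Ico (t 0) (t K)) (k : ℕ) :
    ∫ b, boolValue b ∂bitLaw B F t K i k =
      blockAvg (cellMass (F i) t) (cellIntegral (F i) t (interimAlloc F B i)) k (k + 1) := by
  unfold bitLaw
  rw [integral_bind_of_bounded (measurable_map_servedBit i) (isProbabilityMeasure_map_servedBit i)
    .of_discrete boolValue_mem]
  have e1 : ∀ w, ∫ b, boolValue b ∂(B (drawProfile w)).map (servedBit i w) =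
      if (w i).isRight then serveProb B i (drawProfile w) else 0 := by
    intro w
    rw [integral_map ((measurable_servedBit i).of_uncurry_left (x := w)).aemeasurable
      Measurable.of_discrete.aestronglyMeasurable]
    split_ifs with h
    · have : ∀ S, boolValue (servedBit i w S) =
          {S : Allocation n | i ∈ S}.indicator (fun _ => (1 : ℝ)) S := fun S => by
        by_cases hS : i ∈ S <;> simp [boolValue, servedBit, h, hS]
      simp only [this]
      rw [integral_indicator_const _ (measurableSet_mem i), smul_eq_mul, mul_one]
      rfl
    · simp [boolValue, servedBit, h]
  simp only [e1]
  have hmp := measurePreserving_eval (fun j => sampleLaw F (profileRequest t K i k j)) i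
  have hreq : profileRequest t K i k i = (i, t k, t (k + 1)) := if_pos rfl
  by_cases h0 : F i (Set.Ico (t k) (t (k + 1))) = 0
  · have hae : ∀ᵐ w ∂Measure.pi fun j => sampleLaw F (profileRequest t K i k j),
        (w i).isRight = false := by
      refine hmp.quasiMeasurePreserving.ae (p := fun r => r.isRight = false) ?_
      simp only [hreq]
      rw [sampleLaw_of_zero h0, ae_dirac_iff (p := fun r : Unit ⊕ ℝ => r.isRight = false)
        (measurable_isRight (measurableSet_singleton false))]
      rfl
    have : blockAvg (cellMass (F i) t) (cellIntegral (F i) t (interimAlloc F B i)) k (k + 1) = 0 := by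
      simp [blockAvg, cellMass, measureReal_def, h0]
    rw [this, integral_congr_ae (g := fun _ => (0 : ℝ)) (hae.mono fun w hw => by simp [hw])]
    simp
  · have hae : ∀ᵐ w ∂Measure.pi fun j => sampleLaw F (profileRequest t K i k j),
        (w i).isRight = true := by
      refine hmp.quasiMeasurePreserving.ae (p := fun r => r.isRight = true) ?_
      simp only [hreq]
      rw [sampleLaw_of_pos h0, ae_map_iff (p := fun r : Unit ⊕ ℝ => r.isRight = true)
        measurable_inr.aemeasurable (measurable_isRight (measurableSet_singleton true))]
      simp
    rw [integral_congr_ae (g := fun w => serveProb B i (drawProfile w))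
      (hae.mono fun w hw => by simp [hw]), ← integral_map measurable_drawProfile.aemeasurable
      (measurable_serveProb i).aestronglyMeasurable, map_drawProfile ht0,
      integral_pi_update i _ (measurable_serveProb i) (serveProb_mem i)]
    refine integral_drawLaw ht (measurable_interimAlloc i) (interimAlloc_mem i) (Nat.le_succ k) ?_
    rw [sum_cellMass ht (Nat.le_succ k)]
    exact measureReal_nonneg.lt_of_ne fun h => h0 ((measureReal_eq_zero_iff).1 h.symm)

/-- Tower property: the cell average at a conditional draw from an interval has the interval average
as its mean. -/
lemma integral_cellIndex {h : ℝ → ℝ} (ht : Monotone t) (hK : 0 < K)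
    (hs : ∀ᵐ z ∂F i, z ∈ Set.Ico (t 0) (t K)) (hm : Measurable h)
    (hh : ∀ z, h z ∈ Set.Icc (0 : ℝ) 1) {a b : ℕ} (hb : b ≤ K) :
    ∫ k : Fin (K + 1), blockAvg (cellMass (F i) t) (cellIntegral (F i) t h) k (k + 1)
        ∂(sampleLaw F (i, t a, t b)).map (cellIndex t K) =
      blockAvg (cellMass (F i) t) (cellIntegral (F i) t h) a b := by
  set f := cellMass (F i) t
  set G := cellIntegral (F i) t h
  have hG0 : ∀ k, 0 ≤ G k := cellIntegral_nonneg hh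
  have hGf : ∀ k, G k ≤ f k := cellIntegral_le hm hh
  rw [integral_map (measurable_cellIndex t K).aemeasurable
    Measurable.of_discrete.aestronglyMeasurable]
  by_cases h0 : F i (Set.Ico (t a) (t b)) = 0
  · have e1 : blockAvg f G a b = 0 := by
      rcases le_total a b with hab | hab
      · rw [blockAvg, sum_cellMass ht hab, measureReal_def, h0, ENNReal.toReal_zero, div_zero]
      · simp [blockAvg, Finset.Ico_eq_empty_of_le hab]
    -- The failure index `K` points to a cell above the support, whose average is `0 / 0 = 0`, the
    -- same as that of the null interval.
    have e2 : f K = 0 := by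
      have : F i (Set.Ico (t K) (t (K + 1))) = 0 := by
        refine measure_mono_null (fun z hz => ?_) (show F i (Set.Ico (t 0) (t K))ᶜ = 0 from hs)
        exact fun hz' => absurd hz'.2 (not_lt.2 hz.1)
      simp [f, cellMass, measureReal_def, this]
    rw [sampleLaw_of_zero h0, integral_dirac' _ _ (Measurable.stronglyMeasurable (by
      exact (Measurable.of_discrete (f := fun k : Fin (K + 1) => blockAvg f G k (k + 1))).comp
        (measurable_cellIndex t K))), e1]
    simp [cellIndex, blockAvg, e2]
  · have hab : a ≤ b := by
      by_contra! hba
      exact h0 (by rw [Set.Ico_eq_empty (not_lt.2 (ht hba.le)), measure_empty])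
    rw [sampleLaw_of_pos h0, integral_map measurable_inr.aemeasurable
      (Measurable.aestronglyMeasurable (by
        exact (Measurable.of_discrete (f := fun k : Fin (K + 1) => blockAvg f G k (k + 1))).comp
          (measurable_cellIndex t K))), integral_cond_Ico,
      blockAvg, sum_cellMass ht hab]
    congr 1
    have hc : ∀ z, ((cellIndex t K (Sum.inr z) : Fin (K + 1)) : ℕ) = cell t K z := fun z => by
      simp only [cellIndex, Sum.elim_inr, Fin.val_ofNat]
      exact Nat.mod_eq_of_lt ((cell_lt hK z).trans (Nat.lt_succ_self K))
    simp only [hc]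
    rw [← sum_cellIntegral ht (integral_comp_cell ht hs hK fun k => blockAvg f G k (k + 1)).1 hab]
    refine Finset.sum_congr rfl fun k hk => ?_
    rw [Finset.mem_Ico] at hk
    have e3 : cellIntegral (F i) t (fun z => blockAvg f G (cell t K z) (cell t K z + 1)) k =
        f k * blockAvg f G k (k + 1) := by
      rw [cellIntegral, setIntegral_congr_fun (g := fun _ => blockAvg f G k (k + 1))
        measurableSet_Ico fun z hz => by simp only [cell_eq ht (by omega : k < K) hz]]
      simp [f, cellMass]
    have e4 := sum_mul_blockAvg hG0 hGf k (k + 1)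
    rw [Nat.Ico_succ_singleton, Finset.sum_singleton, Finset.sum_singleton] at e4
    rw [e3, e4]

/-- The estimate of the allocation probability in a cell. -/
def allocEst (d : Data K N) (k : Fin (K + 1)) : ℝ :=
  (∑ j, boolValue (d.1 k j)) / N

/-- The estimate of the average allocation probability between two grid points. -/
def avgEst (d : Data K N) (a b : ℕ) : ℝ :=
  (∑ m, allocEst d (d.2 (Fin.ofNat (K + 1) a) (Fin.ofNat (K + 1) b) m)) / N

/-- The interval between two grid points was observed to have positive probability. -/
def HasMass (d : Data K N) (a b : ℕ) : Prop :=
  ∃ m, d.2 (Fin.ofNat (K + 1) a) (Fin.ofNat (K + 1) b) m ≠ Fin.last K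

/-- The partition into blocks is an ironing of the estimates, up to the slack `s`. -/
def IsIroning (d : Data K N) (s : ℝ) (J : ℕ → ℕ × ℕ) : Prop :=
  IsBlockMap K J ∧ (∀ k < K, HasMass d (J k).1 (J k).2) ∧
    (∀ k < K, ∀ c, (J k).1 ≤ c → c < (J k).2 →
      avgEst d c (J k).2 ≤ avgEst d (J k).1 (J k).2 + s) ∧
    ∀ k k', k ≤ k' → k' < K →
      avgEst d (J k).1 (J k).2 ≤ avgEst d (J k').1 (J k').2 + s

open Classical in
/-- An ironing of the estimates, or the trivial partition if there is none. -/
def chooseBlocks (s : ℝ) (d : Data K N) : ℕ → ℕ × ℕ :=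
  if h : ∃ J, IsIroning d s J then h.choose else fun _ => (0, K)

lemma isBlockMap_chooseBlocks (s : ℝ) (d : Data K N) : IsBlockMap K (chooseBlocks s d) := by
  unfold chooseBlocks
  split_ifs with h
  · exact h.choose_spec.1
  · exact fun k hk => ⟨Nat.zero_le _, hk, le_rfl, fun _ _ _ => rfl⟩

/-- The data for which all estimates have error at most `e`. -/
def goodData (μ : Measure ℝ) (t : ℕ → ℝ) (h : ℝ → ℝ) (K N : ℕ) (e : ℝ) : Set (Data K N) :=
  {d | (∀ k : Fin (K + 1), |allocEst d k -
      blockAvg (cellMass μ t) (cellIntegral μ t h) k (k + 1)| ≤ e) ∧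
    (∀ a b : Fin (K + 1), |(∑ m, blockAvg (cellMass μ t) (cellIntegral μ t h) (d.2 a b m)
      (d.2 a b m + 1)) / N - blockAvg (cellMass μ t) (cellIntegral μ t h) a b| ≤ e) ∧
    ∀ a b : Fin (K + 1), (∃ m, d.2 a b m ≠ Fin.last K) ↔ μ (Set.Ico (t a) (t b)) ≠ 0}

/-- The errors of the cell estimates are averaged, not summed, and contribute `e`; the sampling of
the cells contributes another `e`. -/
lemma avgEst_error {μ : Measure ℝ} {h : ℝ → ℝ} {e : ℝ} (hN : 0 < N) {d : Data K N}
    (hd : d ∈ goodData μ t h K N e) {a b : ℕ} (ha : a ≤ K) (hb : b ≤ K) :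
    |avgEst d a b - blockAvg (cellMass μ t) (cellIntegral μ t h) a b| ≤ 2 * e := by
  obtain ⟨h1, h2, -⟩ := hd
  have hN' : (0 : ℝ) < N := by exact_mod_cast hN
  have h2 := h2 (Fin.ofNat (K + 1) a) (Fin.ofNat (K + 1) b)
  have ea : ((Fin.ofNat (K + 1) a : Fin (K + 1)) : ℕ) = a := Nat.mod_eq_of_lt (by omega)
  have eb : ((Fin.ofNat (K + 1) b : Fin (K + 1)) : ℕ) = b := Nat.mod_eq_of_lt (by omega)
  rw [ea, eb] at h2
  set q := d.2 (Fin.ofNat (K + 1) a) (Fin.ofNat (K + 1) b) with hq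
  have h3 : |avgEst d a b - (∑ m, blockAvg (cellMass μ t) (cellIntegral μ t h) (q m)
      (q m + 1)) / N| ≤ e := by
    rw [avgEst, ← sub_div, ← Finset.sum_sub_distrib, abs_div, abs_of_pos hN', div_le_iff₀ hN']
    refine (Finset.abs_sum_le_sum_abs _ _).trans ((Finset.sum_le_sum fun m _ => h1 (q m)).trans ?_)
    simp [mul_comm]
  have := abs_sub_le (avgEst d a b) ((∑ m, blockAvg (cellMass μ t) (cellIntegral μ t h) (q m)
      (q m + 1)) / N) (blockAvg (cellMass μ t) (cellIntegral μ t h) a b)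
  linarith

lemma hasMass_iff {μ : Measure ℝ} [IsProbabilityMeasure μ] {h : ℝ → ℝ} {e : ℝ} {d : Data K N}
    (ht : Monotone t) (hd : d ∈ goodData μ t h K N e) {a b : ℕ} (hab : a ≤ b) (hb : b ≤ K) :
    HasMass d a b ↔ 0 < ∑ k ∈ Finset.Ico a b, cellMass μ t k := by
  have ea : ((Fin.ofNat (K + 1) a : Fin (K + 1)) : ℕ) = a := Nat.mod_eq_of_lt (by omega)
  have eb : ((Fin.ofNat (K + 1) b : Fin (K + 1)) : ℕ) = b := Nat.mod_eq_of_lt (by omega)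
  have := hd.2.2 (Fin.ofNat (K + 1) a) (Fin.ofNat (K + 1) b)
  rw [ea, eb] at this
  rw [HasMass, this, sum_cellMass ht hab, measureReal_nonneg.lt_iff_ne, ne_comm (a := (0 : ℝ)), ne_eq, ne_eq,
    measureReal_eq_zero_iff]

/-- On good data, the chosen blocks are an ironing of the true averages, up to a small slack. -/
lemma chooseBlocks_spec {μ : Measure ℝ} [IsProbabilityMeasure μ] {h : ℝ → ℝ} {e : ℝ}
    (ht : Monotone t) (hs : ∀ᵐ z ∂μ, z ∈ Set.Ico (t 0) (t K)) (hN : 0 < N)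
    (hm : Measurable h) (hh : ∀ z, h z ∈ Set.Icc (0 : ℝ) 1)
    {d : Data K N} (hd : d ∈ goodData μ t h K N e) :
    (∀ k < K, 0 < ∑ j ∈ Finset.Ico (chooseBlocks (4 * e) d k).1 (chooseBlocks (4 * e) d k).2,
      cellMass μ t j) ∧
    (∀ k < K, ∀ c, (chooseBlocks (4 * e) d k).1 ≤ c → c < (chooseBlocks (4 * e) d k).2 →
      blockAvg (cellMass μ t) (cellIntegral μ t h) c (chooseBlocks (4 * e) d k).2 ≤
        blockAvg (cellMass μ t) (cellIntegral μ t h) (chooseBlocks (4 * e) d k).1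
          (chooseBlocks (4 * e) d k).2 + 8 * e) ∧
    ∀ k k', k ≤ k' → k' < K →
      blockAvg (cellMass μ t) (cellIntegral μ t h) (chooseBlocks (4 * e) d k).1
          (chooseBlocks (4 * e) d k).2 ≤
        blockAvg (cellMass μ t) (cellIntegral μ t h) (chooseBlocks (4 * e) d k').1
          (chooseBlocks (4 * e) d k').2 + 8 * e := by
  have herr : ∀ {a b}, a ≤ K → b ≤ K →
      avgEst d a b ≤ blockAvg (cellMass μ t) (cellIntegral μ t h) a b + 2 * e ∧
        blockAvg (cellMass μ t) (cellIntegral μ t h) a b ≤ avgEst d a b + 2 * e := by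
    intro a b ha hb
    have := abs_le.1 (avgEst_error hN hd ha hb)
    constructor <;> linarith [this.1, this.2]
  -- The exact ironing of the true averages passes the empirical test with slack `4 * e`, since each
  -- comparison involves two estimates with error `2 * e`. Passing back to true averages costs `4 *
  -- e` again.
  have hex : ∃ J, IsIroning d (4 * e) J := by
    have hpos : 0 < ∑ k ∈ Finset.Ico 0 K, cellMass μ t k := by
      rw [sum_cellMass ht (Nat.zero_le K), measureReal_def,
        (prob_compl_eq_zero_iff measurableSet_Ico).1 hs]
      simp
    obtain ⟨J, hJ, hJp, hJW, hJM⟩ := exists_ironing (cellIntegral_nonneg hh)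
      (cellIntegral_le hm hh) K hpos
    refine ⟨J, hJ, fun k hk => ?_, fun k hk c h1 h2 => ?_, fun k k' hkk hk' => ?_⟩
    · obtain ⟨g1, g2, g3, -⟩ := hJ k hk
      exact (hasMass_iff ht hd (g1.trans g2.le) g3).2 (hJp k hk)
    · obtain ⟨g1, g2, g3, -⟩ := hJ k hk
      linarith [(herr (h2.le.trans g3) g3).1, hJW k hk c h1 h2,
        (herr (g1.trans hk.le) g3).2]
    · obtain ⟨g1, g2, g3, -⟩ := hJ k (hkk.trans_lt hk')
      obtain ⟨g1', g2', g3', -⟩ := hJ k' hk'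
      linarith [(herr (g1.trans (hkk.trans hk'.le)) g3).1, hJM k k' hkk hk',
        (herr (g1'.trans hk'.le) g3').2]
  have hspec : IsIroning d (4 * e) (chooseBlocks (4 * e) d) := by
    rw [chooseBlocks, dif_pos hex]
    exact hex.choose_spec
  obtain ⟨hJ, hJp, hJW, hJM⟩ := hspec
  refine ⟨fun k hk => ?_, fun k hk c h1 h2 => ?_, fun k k' hkk hk' => ?_⟩
  · obtain ⟨g1, g2, g3, -⟩ := hJ k hk
    exact (hasMass_iff ht hd (g1.trans g2.le) g3).1 (hJp k hk)
  · obtain ⟨g1, g2, g3, -⟩ := hJ k hk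
    linarith [(herr (h2.le.trans g3) g3).2, hJW k hk c h1 h2, (herr (g1.trans hk.le) g3).1]
  · obtain ⟨g1, g2, g3, -⟩ := hJ k (hkk.trans_lt hk')
    obtain ⟨g1', g2', g3', -⟩ := hJ k' hk'
    linarith [(herr (g1.trans (hkk.trans hk'.le)) g3).2, hJM k k' hkk hk',
      (herr (g1'.trans hk'.le) g3').1]

/-- The oracle fails exactly on null intervals, and a genuine value never has the index `K`. A
single sample therefore decides positivity, without statistical error. -/
lemma ae_hasMass_iff (hK : 0 < K) (hN : 0 < N) (a b : ℝ) :
    ∀ᵐ q ∂Measure.pi fun _ : Fin N => (sampleLaw F (i, a, b)).map (cellIndex t K),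
      (∃ m, q m ≠ Fin.last K) ↔ F i (Set.Ico a b) ≠ 0 := by
  set ν := (sampleLaw F (i, a, b)).map (cellIndex t K) with hν
  have hev : ∀ m : Fin N, ∀ {p : Fin (K + 1) → Prop}, (∀ᵐ k ∂ν, p k) →
      ∀ᵐ q ∂Measure.pi fun _ : Fin N => ν, p (q m) := fun m p hp =>
    (measurePreserving_eval (fun _ : Fin N => ν) m).quasiMeasurePreserving.ae hp
  by_cases h0 : F i (Set.Ico a b) = 0
  · have h1 : ∀ᵐ k ∂ν, k = Fin.last K := by
      rw [hν, ae_map_iff (measurable_cellIndex t K).aemeasurable .of_discrete,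
        sampleLaw_of_zero h0, ae_dirac_iff (p := fun r => cellIndex t K r = Fin.last K)
          (measurable_cellIndex t K (MeasurableSet.of_discrete (s := {k | k = Fin.last K})))]
      ext
      simp [cellIndex]
    filter_upwards [ae_all_iff.2 fun m => hev m h1] with q hq
    simp [hq, h0]
  · have h1 : ∀ᵐ k ∂ν, k ≠ Fin.last K := by
      rw [hν, ae_map_iff (measurable_cellIndex t K).aemeasurable .of_discrete,
        sampleLaw_of_pos h0, ae_map_iff (p := fun r => cellIndex t K r ≠ Fin.last K)
          measurable_inr.aemeasurable
          (measurable_cellIndex t K (MeasurableSet.of_discrete (s := {k | k ≠ Fin.last K})))]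
      refine .of_forall fun z hz => ?_
      have := congrArg Fin.val hz
      simp only [cellIndex, Sum.elim_inr, Fin.val_ofNat, Fin.val_last] at this
      rw [Nat.mod_eq_of_lt ((cell_lt hK z).trans (Nat.lt_succ_self K))] at this
      exact absurd this (cell_lt hK z).ne
    filter_upwards [hev ⟨0, hN⟩ h1] with q hq
    simp only [ne_eq, h0, not_false_eq_true, iff_true]
    exact ⟨_, hq⟩

/-- The data is good with high probability. -/
lemma measureReal_compl_goodData_le (ht : Monotone t) (hK : 0 < K)
    (ht0 : ∀ j, ∀ᵐ z ∂F j, z ∈ Set.Ico (t 0) (t K)) (hN : 0 < N) {e : ℝ} (he : 0 ≤ e) :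
    (dataLaw B F t K N i).real (goodData (F i) t (interimAlloc F B i) K N e)ᶜ ≤
      2 * (K + 1) * (K + 2) * Real.exp (-(2 * N * e ^ 2)) := by
  set h := interimAlloc F B i
  have hm : Measurable h := measurable_interimAlloc i
  have hh : ∀ z, h z ∈ Set.Icc (0 : ℝ) 1 := interimAlloc_mem i
  set avg := blockAvg (cellMass (F i) t) (cellIntegral (F i) t h)
  have mp1 : ∀ k : Fin (K + 1), MeasurePreserving (fun d : Data K N => d.1 k)
      (dataLaw B F t K N i) (Measure.pi fun _ : Fin N => bitLaw B F t K i k) := fun k =>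
    (measurePreserving_eval (fun k : Fin (K + 1) =>
      Measure.pi fun _ : Fin N => bitLaw B F t K i k) k).comp measurePreserving_fst
  have mp2 : ∀ a b : Fin (K + 1), MeasurePreserving (fun d : Data K N => d.2 a b)
      (dataLaw B F t K N i)
      (Measure.pi fun _ : Fin N => (sampleLaw F (i, t a, t b)).map (cellIndex t K)) := fun a b =>
    (measurePreserving_eval (fun b : Fin (K + 1) => Measure.pi fun _ : Fin N =>
      (sampleLaw F (i, t a, t b)).map (cellIndex t K)) b).comp
      ((measurePreserving_eval (fun a : Fin (K + 1) => Measure.pi fun b : Fin (K + 1) =>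
        Measure.pi fun _ : Fin N => (sampleLaw F (i, t a, t b)).map (cellIndex t K)) a).comp
        measurePreserving_snd)
  -- Union bound over `K + 1` cells and `(K + 1) ^ 2` pairs of grid points, in total `(K + 1) * (K +
  -- 2)` Hoeffding events; `E3` is null.
  let E1 : Fin (K + 1) → Set (Data K N) := fun k => {d | e < |allocEst d k - avg k (k + 1)|}
  let E2 : Fin (K + 1) × Fin (K + 1) → Set (Data K N) := fun p =>
    {d | e < |(∑ m, avg (d.2 p.1 p.2 m) (d.2 p.1 p.2 m + 1)) / N - avg p.1 p.2|}
  let E3 : Set (Data K N) := {d | ¬ ∀ a b : Fin (K + 1),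
    (∃ m, d.2 a b m ≠ Fin.last K) ↔ F i (Set.Ico (t a) (t b)) ≠ 0}
  have hsub : (goodData (F i) t h K N e)ᶜ ⊆ ((⋃ k, E1 k) ∪ ⋃ p, E2 p) ∪ E3 := by
    intro d hd
    by_contra hcon
    simp only [Set.mem_union, Set.mem_iUnion, not_or, not_exists] at hcon
    exact hd ⟨fun k => not_lt.1 (hcon.1.1 k), fun a b => not_lt.1 (hcon.1.2 (a, b)),
      not_not.1 hcon.2⟩
  set δ := 2 * Real.exp (-(2 * N * e ^ 2))
  have b1 : ∀ k, (dataLaw B F t K N i).real (E1 k) ≤ δ := by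
    intro k
    have := measure_average_deviation_le (ν := bitLaw B F t K i k) (h := boolValue) .of_discrete
      boolValue_mem hN he
    rw [integral_bitLaw ht ht0] at this
    rw [← (mp1 k).measureReal_preimage MeasurableSet.of_discrete.nullMeasurableSet] at this
    exact this
  have b2 : ∀ p, (dataLaw B F t K N i).real (E2 p) ≤ δ := by
    intro p
    have := measure_average_deviation_le
      (ν := (sampleLaw F (i, t p.1, t p.2)).map (cellIndex t K))
      (h := fun k : Fin (K + 1) => avg k (k + 1)) .of_discrete
      (fun k => blockAvg_mem hm hh _ _) hN he
    rw [integral_cellIndex ht hK (ht0 i) hm hh (Nat.lt_succ_iff.1 p.2.2)] at this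
    rw [← (mp2 p.1 p.2).measureReal_preimage MeasurableSet.of_discrete.nullMeasurableSet] at this
    exact this
  have b3 : (dataLaw B F t K N i).real E3 = 0 := by
    rw [measureReal_eq_zero_iff]
    change ∀ᵐ d ∂dataLaw B F t K N i, _
    exact ae_all_iff.2 fun a => ae_all_iff.2 fun b =>
      (mp2 a b).quasiMeasurePreserving.ae (ae_hasMass_iff hK hN (t a) (t b))
  have c1 := measureReal_iUnion_fintype_le (μ := dataLaw B F t K N i) E1
  have c2 := measureReal_iUnion_fintype_le (μ := dataLaw B F t K N i) E2
  have c1' := Finset.sum_le_sum fun k (_ : k ∈ Finset.univ) => b1 k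
  have c2' := Finset.sum_le_sum fun p (_ : p ∈ Finset.univ) => b2 p
  simp only [Finset.sum_const, Finset.card_univ, Fintype.card_fin, Fintype.card_prod,
    nsmul_eq_mul, Nat.cast_mul, Nat.cast_add, Nat.cast_one] at c1' c2'
  have d1 := measureReal_mono hsub (measure_ne_top (dataLaw B F t K N i) _)
  have d2 := measureReal_union_le (μ := dataLaw B F t K N i) ((⋃ k, E1 k) ∪ ⋃ p, E2 p) E3
  have d3 := measureReal_union_le (μ := dataLaw B F t K N i) (⋃ k, E1 k) (⋃ p, E2 p)
  have : 2 * ((K : ℝ) + 1) * (K + 2) * Real.exp (-(2 * N * e ^ 2)) =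
      (K + 1) * δ + (K + 1) * (K + 1) * δ := by
    simp only [δ]; ring
  linarith

end

end OracleReduction
end

noncomputable section

namespace OracleReduction

variable {n : ℕ}

/-! ### The reduction -/

/-- The law of the output of the reduction: the value of each agent is replaced by a draw from its
block, and the improved algorithm is run on the new profile. -/
def reductionLaw (A : Algorithm n) (F : Fin n → Measure ℝ) (t : ℕ → ℝ) (K N : ℕ) (s : ℝ)
    (v : Profile n) : Measure (Allocation n) :=
  (Measure.pi fun i => replaceLaw F t K i (dataLaw (improved A) F t K N i) (chooseBlocks s)
    (v i)).bind (improved A)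

/-- Each agent gets its own fresh data, which makes the replacements independent across agents. The
final `+ 1` in the calls is the run on the new profile. -/
lemma implements_reductionLaw (t : ℕ → ℝ) (K N : ℕ) (s : ℝ) :
    Implements (n := n) (n * ((K + 1) * N) + 1)
      (n * ((K + 1) * (N * n) + (K + 1) * ((K + 1) * N) + 1))
      fun A F v => reductionLaw A F t K N s v := by
  have h1 : ∀ i : Fin n, Implements (n := n) (X := Profile n) ((K + 1) * N)
      ((K + 1) * (N * n) + (K + 1) * ((K + 1) * N) + 1) fun A F v =>
        replaceLaw F t K i (dataLaw (improved A) F t K N i) (chooseBlocks s) (v i) := by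
    intro i
    have hd := (implements_dataLaw (n := n) t K N i).comap (f := fun _ : Profile n => ())
      measurable_const
    have hm : Measurable fun p : Profile n × Data K N => (p.2, p.1 i) :=
      measurable_snd.prodMk ((measurable_pi_apply i).comp measurable_fst)
    have hs := (Implements.sample (n := n)
      ((measurable_block_request t K i (chooseBlocks s)).comp hm)).map
      (f := fun _ => drawValue) (measurable_drawValue.comp measurable_snd)
    refine ((hd.bind hs).congr fun A _ F _ v => ?_).of_eq (by simp) rfl
    simp only [replaceLaw, drawLaw, Function.comp_apply]
  have h2 := (Implements.pi h1).bind (Implements.query_improved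
    (measurable_snd : Measurable (Prod.snd : Profile n × Profile n → Profile n)))
  exact h2.congr fun A _ F _ v => rfl

section

variable {A : Algorithm n} [IsMarkovKernel A] {F : Fin n → Measure ℝ}
  [∀ i, IsProbabilityMeasure (F i)] {R : Algorithm n} {t : ℕ → ℝ} {K N : ℕ} {s vmax : ℝ}

lemma reduction_feasible (hn : 1 ≤ n) (hv : 0 ≤ vmax) (hF : ∀ i, ∀ᵐ z ∂F i, z ∈ Set.Icc 0 vmax)
    {X : Set (Allocation n)} (hX : ∀ i, {i} ∈ X) (hA : IsFeasibleAlgorithm vmax X A)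
    (hR : ∀ v, R v = reductionLaw A F t K N s v) : IsFeasibleAlgorithm vmax X R := by
  intro v hv'
  have hp : ∀ i, IsProbabilityMeasure (replaceLaw F t K i (dataLaw (improved A) F t K N i)
      (chooseBlocks s) (v i)) := fun i => isProbabilityMeasure_replaceLaw (v i)
  change R v Xᶜ = 0
  rw [hR, reductionLaw, Measure.bind_apply .of_discrete (improved A).measurable.aemeasurable,
    lintegral_eq_zero_iff (Kernel.measurable_coe _ .of_discrete)]
  have hbox : ∀ᵐ u ∂Measure.pi fun i => replaceLaw F t K i (dataLaw (improved A) F t K N i)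
      (chooseBlocks s) (v i), u ∈ valuationBox n vmax :=
    ae_mem_valuationBox fun i => replaceLaw_support hv (hF i) (v i)
  filter_upwards [hbox] with u hu
  exact improved_feasible hn hX hA u hu

lemma isMarkovKernel_reduction (hR : ∀ v, R v = reductionLaw A F t K N s v) :
    IsMarkovKernel R := by
  refine ⟨fun v => ?_⟩
  have hp : ∀ i, IsProbabilityMeasure (replaceLaw F t K i (dataLaw (improved A) F t K N i)
      (chooseBlocks s) (v i)) := fun i => isProbabilityMeasure_replaceLaw (v i)
  rw [hR]
  exact isProbabilityMeasure_bind (improved A).measurable.aemeasurable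
    (.of_forall fun u => inferInstance)

/-- The reduction is almost incentive compatible and loses little welfare. -/
lemma reduction_spec (hn : 1 ≤ n) (hv : 0 ≤ vmax) (hF : ∀ i, ∀ᵐ z ∂F i, z ∈ Set.Icc 0 vmax)
    (ht : Monotone t) (ht0 : t 0 = 0) (hK : 0 < K) (htK : vmax < t K) (hN : 0 < N)
    {ε θ η e : ℝ} (hη0 : 0 ≤ η) (hη1 : 10 * η ≤ 1) (hηε : 10 * η = ε)
    (hθ : t 1 ≤ θ) (hθ' : n * θ ≤ η * muMax F) (hstep : ∀ k, 1 ≤ k → t (k + 1) ≤ (1 + η) * t k)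
    (he : 0 ≤ e)
    (hsmall : n * (8 * e + 2 * (K + 1) * (K + 2) * Real.exp (-(2 * N * e ^ 2))) ≤ η)
    (hR : ∀ v, R v = reductionLaw A F t K N (4 * e) v) :
    IsBIC F vmax (ε * vmax) R ∧ expectedWelfare F A ≤ (1 + ε) * expectedWelfare F R := by
  have hs : ∀ j, ∀ᵐ z ∂F j, z ∈ Set.Ico (t 0) (t K) := fun j => (hF j).mono fun z hz =>
    ⟨ht0 ▸ hz.1, hz.2.trans_lt htK⟩
  have hRm : IsMarkovKernel R := isMarkovKernel_reduction hR
  set B := improved A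
  set τ : Fin n → ℝ → Measure ℝ := fun i =>
    replaceLaw F t K i (dataLaw B F t K N i) (chooseBlocks (4 * e)) with hτ
  have hJ : ∀ d : Data K N, IsBlockMap K (chooseBlocks (4 * e) d) := isBlockMap_chooseBlocks _
  have hint : ∀ i z, interimAlloc F R i z = ∫ w, interimAlloc F B i w ∂τ i z :=
    interimAlloc_replaced (τ := τ) (fun i => measurable_replaceLaw)
      (fun i z => isProbabilityMeasure_replaceLaw z) (fun i => bind_replaceLaw ht hK (hs i) hJ) hR
  set q := 2 * ((K : ℝ) + 1) * (K + 2) * Real.exp (-(2 * N * e ^ 2)) with hq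
  have hq0 : 0 ≤ q := by positivity
  have hn' : (1 : ℝ) ≤ n := by exact_mod_cast hn
  have hsq : 8 * e + q ≤ η := le_trans (le_mul_of_one_le_left (by positivity) hn') hsmall
  have hgood := fun i => measureReal_compl_goodData_le (B := B) (N := N) (i := i) ht hK hs hN he
  have hspec := fun (i : Fin n) (d : Data K N)
    (hd : d ∈ goodData (F i) t (interimAlloc F B i) K N e) =>
    chooseBlocks_spec ht (hs i) hN (measurable_interimAlloc i) (interimAlloc_mem i) hd
  constructor
  · refine isBIC_of_almost_monotone (by linarith) fun i z z' hz => ?_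
    rw [hint, hint]
    have := integral_replaceLaw_le (ρ := dataLaw B F t K N i) ht hK hJ (measurable_interimAlloc i)
      (interimAlloc_mem i) (by positivity) _ (hgood i) (fun d hd => (hspec i d hd).1)
      (fun d hd => (hspec i d hd).2.2) hz
    linarith
  · have hW : expectedWelfare F B ≤ ∑ i, (θ + (1 + η) * (∫ z, z * interimAlloc F R i z ∂F i +
        (8 * e + q) * muMax F)) := by
      rw [expectedWelfare_eq hv hF]
      refine Finset.sum_le_sum fun i _ => ?_
      have := integral_mul_le_replaced (ρ := dataLaw B F t K N i) ht ht0 hK (hs i) hJ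
        (measurable_interimAlloc i) (interimAlloc_mem i) hθ hη0 hstep
        (by positivity : 0 ≤ 8 * e) _ (hgood i) (fun d hd => (hspec i d hd).2.1)
      simp only [hint]
      refine this.trans (add_le_add_right (mul_le_mul_of_nonneg_left
        (add_le_add_right (mul_le_mul_of_nonneg_left ?_ (by positivity)) _) (by linarith)) _)
      exact le_ciSup (f := fun i => ∫ z, z ∂F i) (Set.finite_range _).bddAbove i
    rw [Finset.sum_add_distrib, ← Finset.mul_sum, Finset.sum_add_distrib,
      ← expectedWelfare_eq hv hF] at hW
    simp only [Finset.sum_const, Finset.card_univ, Fintype.card_fin, nsmul_eq_mul] at hW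
    have h1 : expectedWelfare F A ≤ expectedWelfare F B := expectedWelfare_le_improved hn hF
    have h2 : muMax F ≤ expectedWelfare F B := muMax_le_improved hn hF
    have h3 : 0 ≤ expectedWelfare F R := expectedWelfare_nonneg hF
    have h4 : 0 ≤ expectedWelfare F B := expectedWelfare_nonneg hF
    have hμ0 : 0 ≤ muMax F := Real.iSup_nonneg fun i => integral_nonneg_of_ae
      ((hF i).mono fun z hz => hz.1)
    generalize expectedWelfare F B = W at *
    generalize expectedWelfare F R = W' at *
    generalize muMax F = μ at *
    -- The slack of all agents together is at most `η * μ`, and `μ` is in turn bounded by the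
    -- improved welfare.
    have h5 : n * ((8 * e + q) * μ) ≤ η * μ := by
      rw [← mul_assoc]
      exact mul_le_mul_of_nonneg_right hsmall hμ0
    have h6 : η * μ ≤ η * W := mul_le_mul_of_nonneg_left h2 hη0
    have h7 : W ≤ η * W + (1 + η) * (W' + η * W) := by
      refine hW.trans (add_le_add (by linarith) (mul_le_mul_of_nonneg_left ?_ (by linarith)))
      linarith
    have h8 : (1 - 2 * η - η ^ 2) * W ≤ (1 - 2 * η - η ^ 2) * ((1 + ε) * W') := by
      -- Collecting the multiples of `W` in `h7` leaves the factor `1 - 2 * η - η ^ 2`; the choice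
      -- `ε = 10 * η` with `η ≤ 1 / 10` absorbs it with room to spare.
      have h9 : (1 + η) ≤ (1 - 2 * η - η ^ 2) * (1 + ε) := by
        rw [← hηε]
        nlinarith [mul_nonneg hη0 (mul_nonneg hη0 hη0), mul_nonneg hη0 (by linarith : 0 ≤ 1 - 10 * η),
          mul_nonneg (mul_nonneg hη0 hη0) (by linarith : 0 ≤ 1 - 10 * η)]
      nlinarith [mul_le_mul_of_nonneg_right h9 h3]
    exact h1.trans (le_of_mul_le_mul_left h8 (by nlinarith))

end

end OracleReduction
end

noncomputable section

namespace OracleReduction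

/-! ### Parameters -/

/-- A grid with a first cell `[0, θ)` and geometrically increasing cells of ratio `1 + η`. -/
def geomGrid (θ η : ℝ) : ℕ → ℝ
  | 0 => 0
  | k + 1 => θ * (1 + η) ^ k

lemma monotone_geomGrid {θ η : ℝ} (hθ : 0 ≤ θ) (hη : 0 ≤ η) : Monotone (geomGrid θ η) := by
  refine monotone_nat_of_le_succ fun k => ?_
  cases k with
  | zero => simpa [geomGrid] using hθ
  | succ k =>
    exact mul_le_mul_of_nonneg_left (pow_le_pow_right₀ (by linarith) (Nat.le_succ k)) hθ

lemma geomGrid_succ_le {θ η : ℝ} (k : ℕ) (hk : 1 ≤ k) :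
    geomGrid θ η (k + 1) ≤ (1 + η) * geomGrid θ η k := by
  cases k with
  | zero => omega
  | succ k => simp only [geomGrid]; rw [pow_succ]; linarith

lemma half_le_log_one_add {η : ℝ} (hη : 0 < η) (hη1 : η ≤ 1) : η / 2 ≤ Real.log (1 + η) := by
  have h := Real.one_sub_inv_le_log_of_pos (by linarith : 0 < 1 + η)
  have : η / 2 ≤ 1 - (1 + η)⁻¹ := by
    have h1 : 1 - (1 + η)⁻¹ = η / (1 + η) := by field_simp; ring
    rw [h1]
    exact div_le_div_of_nonneg_left hη.le (by linarith) (by linarith)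
  linarith

/-- The grid reaches above `vmax` after few steps. -/
lemma lt_geomGrid {θ η vmax : ℝ} (hθ : 0 < θ) (hη : 0 < η) (hv : 0 < vmax) :
    vmax < geomGrid θ η (⌈Real.log (vmax / θ) / Real.log (1 + η)⌉₊ + 2) := by
  have hl : 0 < Real.log (1 + η) := Real.log_pos (by linarith)
  set m := ⌈Real.log (vmax / θ) / Real.log (1 + η)⌉₊
  have h1 : Real.log (vmax / θ) ≤ m * Real.log (1 + η) :=
    (div_le_iff₀ hl).1 (Nat.le_ceil _)
  have h2 : vmax / θ ≤ (1 + η) ^ m := by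
    rw [← Real.log_pow] at h1
    exact (Real.log_le_log_iff (by positivity) (by positivity)).1 h1
  have h3 : (1 + η) ^ m < (1 + η) ^ (m + 1) := pow_lt_pow_right₀ (by linarith) (Nat.lt_succ_self m)
  have h4 := (div_lt_iff₀ hθ).1 (h2.trans_lt h3)
  change vmax < θ * (1 + η) ^ (m + 1)
  linarith

section

variable {n : ℕ} {ε vmax μ : ℝ}

/-- For small `ε` the argument of the logarithm is at least `2`, and its base `1 + ε` makes the
logarithm of order `1 / ε`. Terms in `1 / ε` are thus covered by the stated complexity. -/
lemma inv_le_two_mul_log (hε : 0 < ε) (hμ : 0 < μ) (hμv : μ ≤ vmax) :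
    ε⁻¹ ≤ 2 * max 1 (Real.logb (1 + ε) (vmax / (ε * μ))) := by
  rcases le_or_gt (1 / 2) ε with h | h
  · have h1 : ε⁻¹ ≤ 2 := by
      rw [inv_le_comm₀ hε (by norm_num)]; linarith
    linarith [le_max_left 1 (Real.logb (1 + ε) (vmax / (ε * μ)))]
  · have hl : 0 < Real.log (1 + ε) := Real.log_pos (by linarith)
    have hl' : Real.log (1 + ε) ≤ ε := by linarith [Real.log_le_sub_one_of_pos (by linarith : 0 < 1 + ε)]
    have hR : 2 ≤ vmax / (ε * μ) := by
      rw [le_div_iff₀ (by positivity)]; nlinarith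
    have h2 : 1 / 2 ≤ Real.log (vmax / (ε * μ)) := by
      have := Real.log_le_log (by norm_num) hR
      linarith [Real.log_two_gt_d9]
    have h3 : ε⁻¹ / 2 ≤ Real.logb (1 + ε) (vmax / (ε * μ)) := by
      rw [Real.logb, le_div_iff₀ hl]
      have : ε⁻¹ / 2 * Real.log (1 + ε) ≤ ε⁻¹ / 2 * ε :=
        mul_le_mul_of_nonneg_left hl' (by positivity)
      have h4 : ε⁻¹ / 2 * ε = 1 / 2 := by field_simp
      linarith
    linarith [le_max_right 1 (Real.logb (1 + ε) (vmax / (ε * μ)))]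

/-- The first cell is smaller than `ε * μ` by the factor `10 * n`, which adds `log (10 * n) / ε`
cells up to constants; `inv_le_two_mul_log` absorbs them into `L` times a logarithm. -/
lemma card_cells_le (hn : 1 ≤ n) (hε : 0 < ε) (hε1 : ε < 1) (hμ : 0 < μ) (hμv : μ ≤ vmax)
    {L Y : ℝ} (hL : L = max 1 (Real.logb (1 + ε) (vmax / (ε * μ)))) (hY3 : 3 ≤ Y)
    (hnY : (n : ℝ) ≤ Y) (hl1 : 1 ≤ Real.log Y) :
    (⌈Real.log (vmax / (ε / 10 * μ / n)) / Real.log (1 + ε / 10)⌉₊ : ℝ) + 4 ≤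
      200 * (Real.log Y * L) := by
  have hn' : (1 : ℝ) ≤ n := by exact_mod_cast hn
  have hv : 0 < vmax := hμ.trans_le hμv
  have hL1 : 1 ≤ L := hL ▸ le_max_left _ _
  have hLε : ε⁻¹ ≤ 2 * L := hL ▸ inv_le_two_mul_log hε hμ hμv
  have hlog1 : 0 < Real.log (1 + ε / 10) := Real.log_pos (by linarith)
  have hlog2 : ε / 10 / 2 ≤ Real.log (1 + ε / 10) :=
    half_le_log_one_add (by positivity) (by linarith)
  have e1 : vmax / (ε / 10 * μ / n) = 10 * n * (vmax / (ε * μ)) := by field_simp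
  have hRpos : 0 < vmax / (ε * μ) := by positivity
  have e2 : Real.log (vmax / (ε / 10 * μ / n)) = Real.log (10 * n) + Real.log (vmax / (ε * μ)) := by
    rw [e1, Real.log_mul (by positivity) hRpos.ne']
  have e3 : Real.log (10 * n) ≤ 4 * Real.log Y := by
    rw [show (4 : ℝ) * Real.log Y = Real.log (Y ^ 4) by rw [Real.log_pow]; norm_num]
    refine Real.log_le_log (by positivity) ?_
    have : (3 : ℝ) ^ 3 ≤ Y ^ 3 := by gcongr
    calc (10 : ℝ) * n ≤ Y ^ 3 * Y := by gcongr; linarith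
      _ = Y ^ 4 := by ring
  have e4 : Real.log (vmax / (ε * μ)) ≤ ε * L := by
    have h1 : Real.logb (1 + ε) (vmax / (ε * μ)) ≤ L := hL ▸ le_max_right _ _
    have h2 : 0 < Real.log (1 + ε) := Real.log_pos (by linarith)
    rw [Real.logb, div_le_iff₀ h2] at h1
    have h3 : Real.log (1 + ε) ≤ ε := by
      linarith [Real.log_le_sub_one_of_pos (by linarith : 0 < 1 + ε)]
    have h4 : L * Real.log (1 + ε) ≤ L * ε := by gcongr
    linarith
  have hR1 : 1 ≤ vmax / (ε * μ) := by
    rw [le_div_iff₀ (by positivity)]; nlinarith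
  have e5 : 0 ≤ Real.log (vmax / (ε / 10 * μ / n)) := by
    rw [e2]
    exact add_nonneg (Real.log_nonneg (by linarith)) (Real.log_nonneg hR1)
  have e6 : Real.log (vmax / (ε / 10 * μ / n)) / Real.log (1 + ε / 10) ≤
      (4 * Real.log Y + ε * L) / (ε / 10 / 2) := by
    have : Real.log (vmax / (ε / 10 * μ / n)) ≤ 4 * Real.log Y + ε * L := by linarith
    exact div_le_div₀ (e5.trans this) this (by positivity) hlog2
  have e7 : (4 * Real.log Y + ε * L) / (ε / 10 / 2) = 80 * (Real.log Y * ε⁻¹) + 20 * L := by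
    field_simp; ring
  have e8 : Real.log Y * ε⁻¹ ≤ Real.log Y * (2 * L) := by gcongr
  have e9 := Nat.ceil_lt_add_one (div_nonneg e5 hlog1.le)
  have e10 : L ≤ Real.log Y * L := le_mul_of_one_le_left (by linarith) hl1
  linarith

/-- The argument of the logarithm is polynomial in `Y`, and accuracy `ε / (160 * n)` gives the
factor `12800 * M`. -/
lemma card_repetitions_le (hn : 1 ≤ n) (hε : 0 < ε) (hε1 : ε < 1) {K M Y : ℝ} (hK : 0 ≤ K)
    (hM : M = (n : ℝ) ^ 2 * ε⁻¹ ^ 2) (hM1 : 1 ≤ M) (hY3 : 3 ≤ Y) (hnY : (n : ℝ) ≤ Y)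
    (hiY : ε⁻¹ ≤ Y) (hKY : K + 2 ≤ 200 * Y ^ 2) (hl1 : 1 ≤ Real.log Y) :
    (⌈Real.log (4 * n * (K + 1) * (K + 2) / (ε / 10)) / (2 * (ε / 10 / (16 * n)) ^ 2)⌉₊ : ℝ) + 1 ≤
      10 ^ 6 * (M * Real.log Y) := by
  have hn' : (1 : ℝ) ≤ n := by exact_mod_cast hn
  have f1 : Real.log (4 * n * (K + 1) * (K + 2) / (ε / 10)) ≤ 20 * Real.log Y := by
    rw [show (20 : ℝ) * Real.log Y = Real.log (Y ^ 20) by rw [Real.log_pow]; norm_num]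
    refine Real.log_le_log (by positivity) ?_
    have h14 : (3 : ℝ) ^ 14 ≤ Y ^ 14 := by gcongr
    have h1 : K + 1 ≤ 200 * Y ^ 2 := by linarith
    calc 4 * (n : ℝ) * (K + 1) * (K + 2) / (ε / 10) = 40 * n * ((K + 1) * (K + 2)) * ε⁻¹ := by
          field_simp; norm_num
      _ ≤ 40 * Y * ((200 * Y ^ 2) * (200 * Y ^ 2)) * Y := by gcongr
      _ = 1600000 * Y ^ 6 := by ring
      _ ≤ Y ^ 14 * Y ^ 6 := by gcongr; linarith
      _ = Y ^ 20 := by ring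
  have f0 : 0 ≤ Real.log (4 * n * (K + 1) * (K + 2) / (ε / 10)) := by
    refine Real.log_nonneg ?_
    rw [le_div_iff₀ (by positivity)]
    calc (1 : ℝ) * (ε / 10) ≤ 4 * 1 * (0 + 1) * (0 + 2) := by linarith
      _ ≤ 4 * n * (K + 1) * (K + 2) := by gcongr
  have f2 : ∀ x : ℝ, x / (2 * (ε / 10 / (16 * n)) ^ 2) = x * (12800 * M) := fun x => by
    rw [hM]; field_simp; ring
  rw [f2]
  have f3 := Nat.ceil_lt_add_one (mul_nonneg f0 (by positivity : 0 ≤ 12800 * M))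
  have f5 : Real.log (4 * n * (K + 1) * (K + 2) / (ε / 10)) * (12800 * M) ≤
      20 * Real.log Y * (12800 * M) := by gcongr
  have f6 : 1 ≤ M * Real.log Y := one_le_mul_of_one_le_of_one_le hM1 hl1
  linarith

/-- The product of agents, cells and repetitions is `n * (l * L) * (M * l) = g * l ^ 2` up to
constants. The sample count is at most of degree `7` in `Y`; the exponent `10` serves both bounds.
-/
lemma calls_and_samples_le {n K N M L g l Y : ℝ} (hn : 0 ≤ n) (hK : 0 ≤ K) (hN : 0 ≤ N)
    (hg : g = n * M * L) (hg1 : 1 ≤ g) (hY : Y = 2 + g) (hnY : n ≤ Y) (hMY : M ≤ Y) (hLY : L ≤ Y)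
    (hl1 : 1 ≤ l) (hlY : l ≤ Y) (hL : 1 ≤ L)
    (hKb : K + 2 ≤ 200 * (l * L)) (hNb : N ≤ 10 ^ 6 * (M * l)) :
    n * ((K + 1) * N) + 1 ≤ 10 ^ 13 * g * l ^ 10 ∧
      n * ((K + 1) * (N * n) + (K + 1) * ((K + 1) * N) + 1) ≤ 10 ^ 13 * (1 + g) ^ 10 := by
  constructor
  · have h0 : K + 1 ≤ 200 * (l * L) := by linarith
    have h1 : n * ((K + 1) * N) ≤ n * ((200 * (l * L)) * (10 ^ 6 * (M * l))) := by gcongr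
    have h2 : n * ((200 * (l * L)) * (10 ^ 6 * (M * l))) = 200 * 10 ^ 6 * g * l ^ 2 := by
      rw [hg]; ring
    have h3 : l ^ 2 ≤ l ^ 10 := pow_le_pow_right₀ hl1 (by norm_num)
    have h4 : 1 ≤ g * l ^ 10 := one_le_mul_of_one_le_of_one_le hg1 (one_le_pow₀ hl1)
    have h5 : 200 * 10 ^ 6 * g * l ^ 2 ≤ 200 * 10 ^ 6 * g * l ^ 10 := by gcongr
    linarith
  · have hY1 : 1 ≤ Y := by linarith
    have hlL : l * L ≤ Y ^ 2 := by rw [pow_two]; gcongr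
    have hMl : M * l ≤ Y ^ 2 := by rw [pow_two]; gcongr
    have hKY : K + 1 ≤ 200 * Y ^ 2 := by linarith
    have hNY : N ≤ 10 ^ 6 * Y ^ 2 := by linarith
    have h1 : n * ((K + 1) * (N * n) + (K + 1) * ((K + 1) * N) + 1) ≤
        Y * ((200 * Y ^ 2) * (10 ^ 6 * Y ^ 2 * Y) +
          (200 * Y ^ 2) * ((200 * Y ^ 2) * (10 ^ 6 * Y ^ 2)) + 1) := by gcongr
    have h2 : Y ^ 6 ≤ Y ^ 7 := pow_le_pow_right₀ hY1 (by norm_num)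
    have h3 : Y ^ 1 ≤ Y ^ 7 := pow_le_pow_right₀ hY1 (by norm_num)
    have h4 : Y ^ 7 ≤ (2 * (1 + g)) ^ 7 := by
      gcongr; linarith
    have h5 : (1 + g) ^ 7 ≤ (1 + g) ^ 10 := pow_le_pow_right₀ (by linarith) (by norm_num)
    rw [mul_pow] at h4
    linarith

lemma complexity_bounds (hn : 1 ≤ n) (hε : 0 < ε) (hε1 : ε < 1) (hμ : 0 < μ) (hμv : μ ≤ vmax)
    {K N : ℕ} (hK : (K : ℝ) =
      (⌈Real.log (vmax / (ε / 10 * μ / n)) / Real.log (1 + ε / 10)⌉₊ : ℝ) + 2)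
    (hN : (N : ℝ) = (⌈Real.log (4 * n * (K + 1) * (K + 2) / (ε / 10)) /
      (2 * (ε / 10 / (16 * n)) ^ 2)⌉₊ : ℝ) + 1) :
    (n : ℝ) * ((K + 1) * N) + 1 ≤ 10 ^ 13 * max 1 (complexityScale n ε vmax μ) *
        Real.log (2 + complexityScale n ε vmax μ) ^ 10 ∧
      (n : ℝ) * ((K + 1) * (N * n) + (K + 1) * ((K + 1) * N) + 1) ≤
        10 ^ 13 * (1 + complexityScale n ε vmax μ) ^ 10 := by
  have hn' : (1 : ℝ) ≤ n := by exact_mod_cast hn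
  obtain ⟨L, hL⟩ : ∃ L, L = max 1 (Real.logb (1 + ε) (vmax / (ε * μ))) := ⟨_, rfl⟩
  have hL1 : 1 ≤ L := hL ▸ le_max_left _ _
  have hi1 : 1 ≤ ε⁻¹ := (one_le_inv₀ hε).2 hε1.le
  obtain ⟨M, hM⟩ : ∃ M, M = (n : ℝ) ^ 2 * ε⁻¹ ^ 2 := ⟨_, rfl⟩
  have hg : complexityScale n ε vmax μ = n * M * L := by
    rw [complexityScale, ← hL, hM, inv_pow]; ring
  generalize complexityScale n ε vmax μ = g at hg ⊢
  have hM1 : 1 ≤ M := hM ▸ one_le_mul_of_one_le_of_one_le (one_le_pow₀ hn') (one_le_pow₀ hi1)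
  have hnM : n ≤ M := by
    rw [hM]
    calc (n : ℝ) = n * 1 := (mul_one _).symm
      _ ≤ n * (n * ε⁻¹ ^ 2) := by
        gcongr; exact one_le_mul_of_one_le_of_one_le hn' (one_le_pow₀ hi1)
      _ = n ^ 2 * ε⁻¹ ^ 2 := by ring
  have hiM : ε⁻¹ ≤ M := by
    rw [hM]
    calc ε⁻¹ = 1 * ε⁻¹ := (one_mul _).symm
      _ ≤ (n ^ 2 * ε⁻¹) * ε⁻¹ := by
        gcongr; exact one_le_mul_of_one_le_of_one_le (one_le_pow₀ hn') hi1
      _ = n ^ 2 * ε⁻¹ ^ 2 := by ring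
  have hMg : M ≤ g := by
    rw [hg, mul_right_comm]
    exact le_mul_of_one_le_left (by linarith) (one_le_mul_of_one_le_of_one_le hn' hL1)
  have hLg : L ≤ g := by
    rw [hg]
    exact le_mul_of_one_le_left (by linarith) (one_le_mul_of_one_le_of_one_le hn' hM1)
  have hl1 : 1 ≤ Real.log (2 + g) := by
    rw [Real.le_log_iff_exp_le (by linarith)]
    linarith [Real.exp_one_lt_d9]
  have hlY : Real.log (2 + g) ≤ 2 + g :=
    (Real.log_le_sub_one_of_pos (by linarith)).trans (by linarith)
  have hKb : (K : ℝ) + 2 ≤ 200 * (Real.log (2 + g) * L) := by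
    have := card_cells_le hn hε hε1 hμ hμv hL (Y := 2 + g) (by linarith) (by linarith) hl1
    linarith
  have hLY : L ≤ 2 + g := by linarith
  have hY0 : 0 ≤ 2 + g := by linarith
  have hKY : (K : ℝ) + 2 ≤ 200 * (2 + g) ^ 2 := by
    refine hKb.trans ?_
    rw [pow_two]
    gcongr
  have hNb : (N : ℝ) ≤ 10 ^ 6 * (M * Real.log (2 + g)) := by
    rw [hN]
    exact card_repetitions_le hn hε hε1 (Nat.cast_nonneg K) hM hM1 (by linarith) (by linarith)
      (by linarith) hKY hl1
  rw [max_eq_right (by linarith)]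
  exact calls_and_samples_le (by linarith) (Nat.cast_nonneg K) (Nat.cast_nonneg N) hg (by linarith)
    rfl (by linarith) (by linarith) (by linarith) hl1 hlY hL1 hKb hNb

lemma exists_parameters (hn : 1 ≤ n) (hε : 0 < ε) (hε1 : ε < 1) (hμ : 0 < μ) (hμv : μ ≤ vmax) :
    ∃ (t : ℕ → ℝ) (K N : ℕ) (e θ : ℝ), Monotone t ∧ t 0 = 0 ∧ 0 < K ∧ vmax < t K ∧ 0 < N ∧
      t 1 ≤ θ ∧ n * θ ≤ ε / 10 * μ ∧ (∀ k, 1 ≤ k → t (k + 1) ≤ (1 + ε / 10) * t k) ∧ 0 ≤ e ∧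
      n * (8 * e + 2 * (K + 1) * (K + 2) * Real.exp (-(2 * N * e ^ 2))) ≤ ε / 10 ∧
      ((n * ((K + 1) * N) + 1 : ℕ) : ℝ) ≤ 10 ^ 13 * max 1 (complexityScale n ε vmax μ) *
        Real.log (2 + complexityScale n ε vmax μ) ^ 10 ∧
      ((n * ((K + 1) * (N * n) + (K + 1) * ((K + 1) * N) + 1) : ℕ) : ℝ) ≤
        10 ^ 13 * (1 + complexityScale n ε vmax μ) ^ 10 := by
  have hn' : (1 : ℝ) ≤ n := by exact_mod_cast hn
  have hv : 0 < vmax := hμ.trans_le hμv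
  set η := ε / 10 with hη
  have hη0 : 0 < η := by positivity
  -- The first cells of all agents together lose `η * μ`. Below, `e` and `lam` are chosen so that
  -- the estimation error and the failure probability, each summed over the agents, take `η / 2`.
  set θ := η * μ / n with hθ
  have hθ0 : 0 < θ := by positivity
  -- One extra index accounts for the shift by the first cell, the other one for strictness above
  -- `vmax`.
  set K := ⌈Real.log (vmax / θ) / Real.log (1 + η)⌉₊ + 2 with hK
  set e := η / (16 * n) with he
  have he0 : 0 < e := by positivity
  set lam := Real.log (4 * n * (K + 1) * (K + 2) / η) with hlam
  set N := ⌈lam / (2 * e ^ 2)⌉₊ + 1 with hN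
  refine ⟨geomGrid θ η, K, N, e, θ, monotone_geomGrid hθ0.le hη0.le, rfl, by omega,
    lt_geomGrid hθ0 hη0 hv, by omega, by simp [geomGrid], ?_, geomGrid_succ_le, he0.le, ?_, ?_⟩
  · rw [hθ]; field_simp; exact le_rfl
  · have h1 : lam ≤ 2 * N * e ^ 2 := by
      have h2 : lam / (2 * e ^ 2) ≤ N := by
        rw [hN]; push_cast; linarith [Nat.le_ceil (lam / (2 * e ^ 2))]
      have := (div_le_iff₀ (by positivity)).1 h2
      linarith
    have h2 : Real.exp (-(2 * N * e ^ 2)) ≤ (4 * n * (K + 1) * (K + 2) / η)⁻¹ := by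
      rw [← Real.exp_log (by positivity : 0 < 4 * (n : ℝ) * (K + 1) * (K + 2) / η), ← Real.exp_neg]
      exact Real.exp_le_exp.2 (by linarith)
    have h3 : n * (8 * e) = η / 2 := by rw [he]; field_simp; norm_num
    have h4 : (n : ℝ) * (2 * (K + 1) * (K + 2) * (4 * n * (K + 1) * (K + 2) / η)⁻¹) = η / 2 := by
      field_simp; norm_num
    have h5 : (n : ℝ) * (2 * (K + 1) * (K + 2) * Real.exp (-(2 * N * e ^ 2))) ≤
        n * (2 * (K + 1) * (K + 2) * (4 * n * (K + 1) * (K + 2) / η)⁻¹) := by gcongr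
    linarith
  have := complexity_bounds hn hε hε1 hμ hμv (K := K) (N := N) (by rw [hK]; push_cast; rfl)
    (by rw [hN]; push_cast; rfl)
  push_cast
  exact this

end

end OracleReduction
end

/-! ### Trivial parameter ranges and conclusion -/

noncomputable section

namespace OracleReduction

variable {n : ℕ}

/-- The program that runs the algorithm once on the reported profile. -/
lemma exists_trivial_program : ∃ P : OracleProgram n (Profile n), P.calls = 1 ∧ P.samples = 0 ∧
    ∀ (A : Algorithm n) [IsMarkovKernel A] (F : Fin n → Measure ℝ)
      [∀ i, IsProbabilityMeasure (F i)] (v : Profile n), P.run A F v = A v :=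
  (Implements.query (measurable_id : Measurable (id : Profile n → Profile n))).exists_program

lemma complexityScale_nonneg (n : ℕ) (ε vmax μ : ℝ) : 0 ≤ complexityScale n ε vmax μ := by
  unfold complexityScale
  positivity

lemma muMax_le {F : Fin n → Measure ℝ} [∀ i, IsProbabilityMeasure (F i)] {vmax : ℝ}
    (hv : 0 ≤ vmax) (hF : ∀ i, ∀ᵐ z ∂F i, z ∈ Set.Icc 0 vmax) : muMax F ≤ vmax := by
  refine Real.iSup_le (fun i => ?_) hv
  have := integral_mono_ae (μ := F i) (.of_mem_Icc 0 vmax measurable_id.aemeasurable (hF i))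
    (integrable_const vmax) ((hF i).mono fun z hz => hz.2)
  simpa using this

/-- An algorithm that loses a factor `1 + ε` in expected welfare loses at most this factor in its
Bayesian approximation guarantee. -/
lemma isBayesianApprox_of_welfare_le {F : Fin n → Measure ℝ} {X : Set (Allocation n)}
    {A R : Algorithm n} {β ε : ℝ} (hε : 0 < ε) (hA : IsBayesianApprox F X β A)
    (h : expectedWelfare F A ≤ (1 + ε) * expectedWelfare F R) :
    IsBayesianApprox F X (β * (1 + ε)) R := by
  unfold IsBayesianApprox at hA ⊢
  rw [← div_div, div_le_iff₀ (by linarith), mul_comm]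
  exact hA.trans h

/-- The construction needs `ε < 1` and `μ ≤ vmax`. Otherwise running the algorithm once on the
reports suffices: for `ε ≥ 1` every algorithm meets the incentive bound, and for `μ > vmax` no
distributions qualify. -/
lemma exists_reduction (hn : 1 ≤ n) {ε vmax μ : ℝ} (hε : 0 < ε) (hv : 0 < vmax) (hμ : 0 < μ) :
    ∃ P : OracleProgram n (Profile n),
      (P.calls : ℝ) ≤ 10 ^ 13 * max 1 (complexityScale n ε vmax μ) *
        Real.log (2 + complexityScale n ε vmax μ) ^ 10 ∧
      (P.samples : ℝ) ≤ 10 ^ 13 * (1 + complexityScale n ε vmax μ) ^ 10 ∧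
      ∀ (F : Fin n → Measure ℝ) [∀ i, IsProbabilityMeasure (F i)],
        (∀ i, ∀ᵐ z ∂F i, z ∈ Set.Icc 0 vmax) → muMax F = μ →
        ∀ (X : Set (Allocation n)), (∀ i, {i} ∈ X) → ∀ (A : Algorithm n) [IsMarkovKernel A],
          IsFeasibleAlgorithm vmax X A →
          IsFeasibleAlgorithm vmax X (P.run A F) ∧ IsBIC F vmax (ε * vmax) (P.run A F) ∧
            expectedWelfare F A ≤ (1 + ε) * expectedWelfare F (P.run A F) := by
  by_cases h : ε < 1 ∧ μ ≤ vmax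
  · obtain ⟨t, K, N, e, θ, ht, ht0, hK, htK, hN, hθ, hθ', hstep, he, hsmall, hcalls, hsamples⟩ :=
      exists_parameters hn hε h.1 hμ h.2
    obtain ⟨P, hPc, hPs, hP⟩ := (implements_reductionLaw (n := n) t K N (4 * e)).exists_program
    refine ⟨P, hPc ▸ hcalls, hPs ▸ hsamples, fun F _ hF hμF X hX A _ hA => ⟨?_, ?_⟩⟩
    · exact reduction_feasible hn hv.le hF hX hA (hP A F)
    · exact reduction_spec hn hv.le hF ht ht0 hK htK hN (by positivity) (by linarith [h.1])
        (by ring) hθ (hμF ▸ hθ') hstep he hsmall (hP A F)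
  · obtain ⟨P, hPc, hPs, hP⟩ := exists_trivial_program (n := n)
    have hg := complexityScale_nonneg n ε vmax μ
    refine ⟨P, ?_, ?_, fun F _ hF hμF X hX A _ hA => ?_⟩
    -- Here the logarithm may be below one; the constant `10 ^ 13` outweighs `(1 / 2) ^ 10`.
    · have hl : 1 / 2 ≤ Real.log (2 + complexityScale n ε vmax μ) := by
        have := Real.log_le_log (by norm_num) (by linarith : 2 ≤ 2 + complexityScale n ε vmax μ)
        linarith [Real.log_two_gt_d9]
      rw [hPc]
      calc ((1 : ℕ) : ℝ) ≤ 10 ^ 13 * 1 * (1 / 2) ^ 10 := by norm_num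
        _ ≤ _ := by
          gcongr
          exact le_max_left _ _
    · rw [hPs]
      push_cast
      positivity
    · have hR : P.run A F = A := Kernel.ext fun v => hP A F v
      rw [hR]
      refine ⟨hA, ?_, le_mul_of_one_le_left (expectedWelfare_nonneg hF) (by linarith)⟩
      have hε1 : 1 ≤ ε := by
        by_contra! hε1
        exact h ⟨hε1, hμF ▸ muMax_le hv.le hF⟩
      -- Interim allocations lie in `[0, 1]`, so they are monotone up to `ε ≥ 1` for free.
      refine isBIC_of_almost_monotone hε.le fun i z z' _ => ?_
      linarith [(interimAlloc_mem (B := A) (F := F) i z).2,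
        (interimAlloc_mem (B := A) (F := F) i z').1]

end OracleReduction

end

theorem mainTheorem5 :
    ∃ (C : ℝ) (c : ℕ), 0 < C ∧
      ∀ (n : ℕ), 1 ≤ n → ∀ (ε vmax μ : ℝ), 0 < ε → 0 < vmax → 0 < μ →
        ∃ P : OracleReduction.OracleProgram n (OracleReduction.Profile n),
          (P.calls : ℝ) ≤ C * max 1 (OracleReduction.complexityScale n ε vmax μ) *
              Real.log (2 + OracleReduction.complexityScale n ε vmax μ) ^ c ∧
          (P.samples : ℝ) ≤ C * (1 + OracleReduction.complexityScale n ε vmax μ) ^ c ∧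
          ∀ (F : Fin n → Measure ℝ)
            [∀ i, IsProbabilityMeasure (F i)],
            (∀ i, ∀ᵐ z ∂F i, z ∈ Set.Icc 0 vmax) →
            OracleReduction.muMax F = μ →
            ∀ (X : Set (OracleReduction.Allocation n)), IsLowerSet X → (∀ i, {i} ∈ X) →
            ∀ (A : OracleReduction.Algorithm n) [IsMarkovKernel A],
              OracleReduction.IsFeasibleAlgorithm vmax X A →
              OracleReduction.IsFeasibleAlgorithm vmax X (P.run A F) ∧
              OracleReduction.IsBIC F vmax (ε * vmax) (P.run A F) ∧
              ∀ β : ℝ, 0 < β → OracleReduction.IsBayesianApprox F X β A →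
                OracleReduction.IsBayesianApprox F X (β * (1 + ε)) (P.run A F) := by
  refine ⟨10 ^ 13, 10, by norm_num, fun n hn ε vmax μ hε hv hμ => ?_⟩
  obtain ⟨P, hc, hs, hP⟩ := OracleReduction.exists_reduction hn hε hv hμ
  refine ⟨P, hc, hs, fun F _ hF hμF X _ hX A _ hA => ?_⟩
  obtain ⟨h1, h2, h3⟩ := hP F hF hμF X hX A hA
  exact ⟨h1, h2, fun β _ hβ => OracleReduction.isBayesianApprox_of_welfare_le hε hβ h3⟩
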